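/- Let $L^2=L^2([0,1])$ (real-valued functions) with inner product $\langle\cdot,\cdot\rangle$, let $S\in\mathbb N$, and let $\{\psi_{lk}: l\in\mathcal L,\ k\in\mathcal Z_l\}$, with $\mathcal L\subset\mathbb Z$ and finite $\mathcal Z_l\subset\mathbb Z$, be an orthonormal basis of $L^2$ consisting of functions that are $S$ times differentiable with all derivatives in $L^2$. Let $(a_l)$ be its characteristic sequence, where either (a) $|\mathcal Z_l|=1$ and $a_l=\max(2,|l|)$ for all $l\in\mathcal L$, or (b) $\mathcal L\subset\{1,2,\dots\}$ and $a_l=|\mathcal Z_l|=2^l$ for all $l\in\mathcal L$. For $\delta>1/2$ let $H(\delta)$ be the Hilbert space of all $x$ (identified with their coefficients $x_{lk}$; $x_{lk}=\langle\psi_{lk},x\rangle$ if $x\in L^2$) with $$\|x\|_{H(\delta)}^2=\sum_{l\in\mathcal L}\frac{1}{a_l(\log a_l)^{2\delta}}\sum_{k\in\mathcal Z_l}|x_{lk}|^2<\infty ,$$ so that $L^2\subset H(\delta)$. Let $\mathbb W$ be standard white noise, i.e. the random element of $H(\delta)$ with i.i.d. $N(0,1)$ coefficients, let $\mathcal N$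 be its law on $H(\delta)$, and for $f\in L^2$, $n\ge1$ let $P_f^n$ be the law of the observation $\mathbb X^{(n)}=f+n^{-1/2}\mathbb W$. Let $\varphi$ be a probability density on $\mathbb R$, let $\sigma_l>0$ with $\sum_{l,k}\sigma_l^2<\infty$, and let $\Pi$ be the product prior on $L^2$, i.e. the law of $f=\sum_{l,k}\theta_{lk}\psi_{lk}$ with independent $\theta_{lk}$ having density $\varphi_{lk}=\sigma_l^{-1}\varphi(\cdot/\sigma_l)$. Let $\Pi_n=\Pi(\cdot\mid\mathbb X^{(n)})$ be the posterior distribution. Let $f_0\in L^2$ have coefficients $\theta_{0,lk}=\langle f_0,\psi_{lk}\rangle$ and assume: 1. $\sup_{l,k}|\theta_{0,lk}|/\sigma_l\le M$ for some finite $M>0$; 2. for some $\tau>M$ and $0<c_\varphi\le C_\varphi<\infty$: $\varphi(x)\le C_\varphi$ for all $x\in\mathbb R$, $\varphi(x)\ge c_\varphi$ for all $x\in(-\tau,\tau)$, and $\int_{\mathbb R}x^2\varphi(x)\,dx<\infty$; 3. for all $l\in\mathcal L$, $k\in\mathcal Z_l$, the density $\varphi_{lk}$ is continuous near $\theta_{0,lk}$,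 i.e. $\varphi$ is continuous in a neighbourhood of $\theta_{0,lk}/\sigma_l$. Let $\delta>1/2$ be arbitrary, let $\bar f_n=\int f\,d\Pi(f\mid\mathbb X^{(n)})$ be the posterior (Bochner) mean, and, conditionally on $\mathbb X^{(n)}$, let $Y_n$ be drawn from the image of $\Pi_n$ under $f\mapsto\sqrt n\,(f-\mathbb X^{(n)})$. Then, for every $n\ge1$, $P_{f_0}^n$-almost surely, $\bar f_n$ and $E[Y_n\mid\mathbb X^{(n)}]$ exist as Bochner integrals and $E[Y_n\mid\mathbb X^{(n)}]=\sqrt n\,(\bar f_n-\mathbb X^{(n)})$; and, as $n\to\infty$, $$\sqrt n\,(\bar f_n-\mathbb X^{(n)})\to 0\quad\text{in } H(\delta)\text{ in } P_{f_0}^n\text{-probability},$$ that is, $\bar f_n$ is asymptotically linear in $H(\delta)$ with respect to $\mathbb X^{(n)}$. Consequently $\bar f_n$ is asymptotically efficient in $H(\delta)$: for every $h\in L^2$ (in particular $h=0$), with $f_n=f_0+h/\sqrt n$, the laws of $\sqrt n\,(\bar f_n-f_n)$ under $P_{f_n}^n$ converge weakly in $H(\delta)$ to $\mathcal N$, the law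 of $\sqrt n\,(\mathbb X^{(n)}-f_n)$. -/

import Mathlib

open MeasureTheory ProbabilityTheory Filter Topology
open scoped ENNReal

noncomputable section

namespace WhiteNoise

/-- Lebesgue measure on `[0,1]`. -/
abbrev unitVol : Measure ℝ := volume.restrict (Set.Icc (0 : ℝ) 1)

/-- The (real) Hilbert space `L² = L²([0,1])`, with its Borel σ-algebra. -/
abbrev L2 : Type := Lp ℝ 2 unitVol

instance : MeasurableSpace L2 := borel L2

instance : BorelSpace L2 := ⟨rfl⟩

instance : SecondCountableTopology L2 :=
  have : Fact ((2 : ℝ≥0∞) ≠ ⊤) := ⟨ENNReal.ofNat_ne_top⟩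
  inferInstance

/-- An `S`-regular orthonormal basis `{ψ_{lk} : l ∈ 𝓛, k ∈ 𝓩_l}` of `L²([0,1])` with
characteristic sequence `a_l`, either with one function per level or with `2^l` functions per level. In the second case the levels are
positive integers, so that `log a_l > 0` in both cases. -/
structure RegularBasis (S : ℕ) where
  /-- the set of levels `𝓛 ⊆ ℤ` -/
  L : Set ℤ
  /-- the index set `𝓩_l ⊆ ℤ` of level `l` -/
  Z : ℤ → Finset ℤ
  /-- the characteristic sequence `a_l` -/
  a : ℤ → ℝ
  /-- the functions `ψ_{lk}` on `[0,1]` -/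
  ψ : ℤ → ℤ → ℝ → ℝ
  differentiable : ∀ l ∈ L, ∀ k ∈ Z l, ∀ j < S,
    DifferentiableOn ℝ (iteratedDerivWithin j (ψ l k) (Set.Icc 0 1)) (Set.Icc 0 1)
  deriv_memLp : ∀ l ∈ L, ∀ k ∈ Z l, ∀ j ≤ S,
    MemLp (iteratedDerivWithin j (ψ l k) (Set.Icc 0 1)) 2 unitVol
  /-- the `ψ_{lk}` as an orthonormal basis (complete orthonormal system) of `L²` -/
  basis : HilbertBasis {p : ℤ × ℤ // p.1 ∈ L ∧ p.2 ∈ Z p.1} ℝ L2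
  basis_ae_eq : ∀ i, basis i =ᵐ[unitVol] ψ i.1.1 i.1.2
  type_a_or_b :
    (∀ l ∈ L, (Z l).card = 1 ∧ a l = max 2 |(l : ℝ)|) ∨
    (∀ l ∈ L, 1 ≤ l ∧ (Z l).card = 2 ^ l.toNat ∧ a l = 2 ^ l.toNat)

namespace RegularBasis

variable {S : ℕ} (B : RegularBasis S)

/-- The pairs `(l,k)` with `l ∈ 𝓛`, `k ∈ 𝓩_l`. -/
abbrev Idx : Type := {p : ℤ × ℤ // p.1 ∈ B.L ∧ p.2 ∈ B.Z p.1}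

/-- The coefficient `⟨ψ_{lk}, f⟩` of `f ∈ L²`. -/
def coeff (f : L2) (i : B.Idx) : ℝ := inner ℝ (B.basis i) f

/-- The weight `a_l^{2s} / (log a_l)^{2δ}` of the logarithmic Sobolev norm. -/
def weight (s δ : ℝ) (i : B.Idx) : ℝ :=
  B.a i.1.1 ^ (2 * s) / Real.log (B.a i.1.1) ^ (2 * δ)

/-- The weight as a measure on the indices: the pair `(l,k)` has mass `weight s δ (l,k)`. -/
def weightMeasure (s δ : ℝ) : Measure B.Idx :=
  Measure.count.withDensity fun i => ENNReal.ofReal (B.weight s δ i)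

instance (s δ : ℝ) : SigmaFinite (B.weightMeasure s δ) := by
  unfold weightMeasure
  exact SigmaFinite.withDensity_of_ne_top (by simp)

/-- The logarithmic Sobolev space `H^{s,δ}_2`. An element is identified with the array of its
coefficients `x_{lk}` (for `s < 0`, the values of the linear form at the `ψ_{lk}`), and
`‖x‖² = ∑_{l,k} a_l^{2s} (log a_l)^{-2δ} |x_{lk}|²`. -/
abbrev LogSobolev (s δ : ℝ) : Type := Lp ℝ 2 (B.weightMeasure s δ)

/-- `H(δ) = H^{-1/2,δ}_2`. -/
abbrev H (δ : ℝ) : Type := B.LogSobolev (-1 / 2) δ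

instance (δ : ℝ) : MeasurableSpace (B.H δ) := borel (B.H δ)

instance (δ : ℝ) : BorelSpace (B.H δ) := ⟨rfl⟩

instance (δ : ℝ) : SecondCountableTopology (B.H δ) :=
  have : Fact ((2 : ℝ≥0∞) ≠ ⊤) := ⟨ENNReal.ofNat_ne_top⟩
  inferInstance

open Classical in
/-- The element of `H(δ)` with coefficients `x_{lk}` (and `0` if `x ∉ H(δ)`). -/
def ofCoeff (δ : ℝ) (x : B.Idx → ℝ) : B.H δ :=
  if h : MemLp x 2 (B.weightMeasure (-1 / 2) δ) then h.toLp x else 0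

/-- The injection `L² ⊆ H(δ)`. -/
def embed (δ : ℝ) (f : L2) : B.H δ := B.ofCoeff δ (B.coeff f)

/-- The law of an array of i.i.d. `N(0,1)` variables `ε_{lk}`. -/
def gaussianArray : Measure (B.Idx → ℝ) := Measure.infinitePi fun _ => gaussianReal 0 1

/-- The standard Gaussian measure `𝒩` on `H(δ)`: the law of the white noise `𝕎`, whose
coefficients `𝕎(ψ_{lk})` are i.i.d. `N(0,1)`. -/
def stdGaussian (δ : ℝ) : Measure (B.H δ) := B.gaussianArray.map (B.ofCoeff δ)

/-- `P_f^n`: the law on `H(δ)` of the observation `𝕏⁽ⁿ⁾ = f + 𝕎 / √n`. -/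
def obsLaw (δ : ℝ) (n : ℕ) (f : L2) : Measure (B.H δ) :=
  (B.stdGaussian δ).map fun w => B.embed δ f + (√(n : ℝ))⁻¹ • w

lemma measurable_ofCoeff (δ : ℝ) : Measurable (B.ofCoeff δ) := by
  classical
  have hjoint : ∀ c : B.Idx → ℝ, Measurable fun x : B.Idx → ℝ =>
      eLpNorm (x - c) 2 (B.weightMeasure (-1 / 2) δ) := by
    intro c
    simp only [eLpNorm_eq_lintegral_rpow_enorm_toReal two_ne_zero ENNReal.ofNat_ne_top]
    refine Measurable.pow_const (Measurable.lintegral_prod_right'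
      (f := fun p : (B.Idx → ℝ) × B.Idx => ‖(p.1 - c) p.2‖ₑ ^ (2 : ℝ≥0∞).toReal) ?_) _
    refine measurable_from_prod_countable_left fun i => ?_
    simp only [Pi.sub_apply]
    fun_prop
  have hS : MeasurableSet {x : B.Idx → ℝ | MemLp x 2 (B.weightMeasure (-1 / 2) δ)} := by
    have : {x : B.Idx → ℝ | MemLp x 2 (B.weightMeasure (-1 / 2) δ)} =
        {x | eLpNorm (x - 0) 2 (B.weightMeasure (-1 / 2) δ) < ⊤} := by
      ext x
      simp only [Set.mem_ofPred_eq, sub_zero]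
      exact ⟨fun h => h.2, fun h => ⟨(measurable_of_countable x).aestronglyMeasurable, h⟩⟩
    rw [this]
    exact measurableSet_lt (hjoint 0) measurable_const
  have hdist : ∀ c : B.H δ, Measurable fun x => edist (B.ofCoeff δ x) c := by
    intro c
    have : (fun x => edist (B.ofCoeff δ x) c) = fun x =>
        if MemLp x 2 (B.weightMeasure (-1 / 2) δ) then
          eLpNorm (x - (c : B.Idx → ℝ)) 2 (B.weightMeasure (-1 / 2) δ) else edist 0 c := by
      funext x
      by_cases h : MemLp x 2 (B.weightMeasure (-1 / 2) δ)
      · simp only [ofCoeff, dif_pos h, if_pos h, Lp.edist_def]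
        exact eLpNorm_congr_ae (h.coeFn_toLp.sub (ae_eq_refl _))
      · simp only [ofCoeff, dif_neg h, if_neg h]
    rw [this]
    exact Measurable.ite hS (hjoint c) measurable_const
  refine measurable_of_isOpen fun U hU => ?_
  obtain ⟨T, hT, hTU⟩ := TopologicalSpace.isOpen_iUnion_countable
    (fun p : {p : B.H δ × ℝ≥0∞ // Metric.eball p.1 p.2 ⊆ U} => Metric.eball p.1.1 p.1.2)
    (fun _ => Metric.isOpen_eball)
  have hU' : U = ⋃ p ∈ T, Metric.eball p.1.1 p.1.2 := by
    rw [hTU]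
    refine Set.Subset.antisymm (fun y hy => ?_) (Set.iUnion_subset fun p => p.2)
    obtain ⟨r, hr, hrU⟩ := EMetric.isOpen_iff.1 hU y hy
    exact Set.mem_iUnion.2 ⟨⟨(y, r), hrU⟩, Metric.mem_eball_self hr⟩
  rw [hU', Set.preimage_iUnion₂]
  exact MeasurableSet.biUnion hT fun p _ => measurableSet_lt (hdist _) measurable_const

lemma measurable_embed (δ : ℝ) : Measurable (B.embed δ) := by
  refine (B.measurable_ofCoeff δ).comp (measurable_pi_lambda _ fun i => ?_)
  exact (continuous_const.inner continuous_id).measurable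

instance : IsProbabilityMeasure B.gaussianArray := by
  unfold gaussianArray; infer_instance

instance (δ : ℝ) : IsProbabilityMeasure (B.stdGaussian δ) :=
  Measure.isProbabilityMeasure_map (B.measurable_ofCoeff δ).aemeasurable

instance (δ : ℝ) (n : ℕ) (f : L2) : IsProbabilityMeasure (B.obsLaw δ n f) :=
  Measure.isProbabilityMeasure_map (by fun_prop)

/-- The white noise experiment `f ↦ P_f^n` as a Markov kernel from `L²` to `H(δ)`. -/
def experiment (δ : ℝ) (n : ℕ) : Kernel L2 (B.H δ) where
  toFun := B.obsLaw δ n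
  measurable' := by
    have hm : Measurable fun p : L2 × B.H δ => B.embed δ p.1 + (√(n : ℝ))⁻¹ • p.2 :=
      ((B.measurable_embed δ).comp measurable_fst).add (measurable_snd.const_smul (√(n : ℝ))⁻¹)
    refine Measure.measurable_of_measurable_coe _ fun s hs => ?_
    have : (fun f => B.obsLaw δ n f s) = fun f =>
        B.stdGaussian δ (Prod.mk f ⁻¹'
          ((fun p : L2 × B.H δ => B.embed δ p.1 + (√(n : ℝ))⁻¹ • p.2) ⁻¹' s)) := by
      funext f
      exact Measure.map_apply (by fun_prop) hs
    rw [this]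
    exact measurable_measure_prodMk_left (hm hs)

instance (δ : ℝ) (n : ℕ) : IsMarkovKernel (B.experiment δ n) :=
  ⟨fun f => inferInstanceAs (IsProbabilityMeasure (B.obsLaw δ n f))⟩

/-- The law `π_{lk}` on `ℝ` with Lebesgue density `φ_{lk} = σ_l⁻¹ φ(· / σ_l)`. -/
def coordLaw (φ : ℝ → ℝ) (σ : ℤ → ℝ) (i : B.Idx) : Measure ℝ :=
  volume.withDensity fun x => ENNReal.ofReal ((σ i.1.1)⁻¹ * φ (x / σ i.1.1))

/-- The product prior `Π = ⨂_{lk} π_{lk}` on `L²`: the law of `f = ∑_{l,k} θ_{lk} ψ_{lk}` with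
independent coefficients `θ_{lk} ∼ π_{lk}`. -/
def productPrior (φ : ℝ → ℝ) (σ : ℤ → ℝ) : Measure L2 :=
  (Measure.infinitePi (B.coordLaw φ σ)).map fun θ => ∑' i, θ i • (B.basis i : L2)

instance (φ : ℝ → ℝ) (σ : ℤ → ℝ) : IsFiniteMeasure (B.productPrior φ σ) := by
  have : IsFiniteMeasure (Measure.infinitePi (B.coordLaw φ σ)) := by
    by_cases h : ∀ i, IsProbabilityMeasure (B.coordLaw φ σ i)
    · infer_instance
    · rw [Measure.infinitePi, dif_neg h]; infer_instance
  unfold productPrior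
  infer_instance

/-- `post` is (a version of) the posterior distribution `Π(· | 𝕏⁽ⁿ⁾)` on `L²` for the prior `Π`:
it agrees with the posterior kernel outside a null set of the marginal law of `𝕏⁽ⁿ⁾`. -/
def IsPosterior (δ : ℝ) (n : ℕ) (prior : Measure L2) [IsFiniteMeasure prior]
    (post : Kernel (B.H δ) L2) : Prop :=
  post =ᵐ[B.experiment δ n ∘ₘ prior] posterior (B.experiment δ n) prior

end RegularBasis

/-- The posterior mean `∫ f dΠ(f | x)`, a Bochner integral in `L²`. -/
def postMean {X : Type*} [MeasurableSpace X] (post : Kernel X L2) (x : X) : L2 :=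
  ∫ f, f ∂(post x)

end WhiteNoise

end

noncomputable section

namespace WhiteNoise

/-! Prior and noise are both products, so the coefficients of the posterior mean can be computed one
at a time, each from its own observed coefficient (`ae_integral_coeff_post`). In the local variable
z = √n (θ - x), the scalar posterior is N(0,1) tilted by the factor φ((x + z/√n)/σ). Each coordinate
of √n (f̄_n - 𝕏) is therefore the mean of a tilted Gaussian (`ae_postDev_coord`). Under P_{f₀}^n one
has x = θ₀ + ε/√n, and the tilt becomes φ(t₀ + (ε + z)/s) with t₀ = θ₀/σ and s = σ√n.

Two facts about this scalar mean carry the proof. For a fixed coordinate s → ∞, the tilt flattens to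
the nonzero constant φ(t₀), and the mean square of the tilted mean tends to 0
(`tendsto_lintegral_tiltedMean_sq`). Moreover this mean square is bounded uniformly in |t₀| ≤ M and
s > 0 (`exists_lintegral_tiltedMean_sq_le`), because the slack τ - M gives a lower bound on the
normalizing constant. The weights of H(δ) are summable for δ > 1/2 (`summable_weight`), so dominated
convergence over the indices gives convergence to 0 in mean square, hence in probability.

The Cameron-Martin inequality `obsLaw_add_sq_le` is used twice. The posterior is determined only up
to null sets of the marginal law of 𝕏, and mutual absolute continuity of the P_f^n moves such
statements to P_{f₀}^n. Its bound is uniform along shifts h/√n, so convergence to 0 in probability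
persists under the local alternatives. There √n (f̄_n - f_n) equals the white noise plus a
negligible term, and Slutsky's lemma concludes. -/

/-! ### Product measures and the Cameron-Martin inequality. -/

lemma measurable_update_pair {ι : Type*} [DecidableEq ι] {X : ι → Type*}
    [∀ i, MeasurableSpace (X i)] (i : ι) :
    Measurable fun p : X i × (∀ j, X j) => Function.update p.2 i p.1 := by
  refine measurable_pi_lambda _ fun j => ?_
  by_cases h : j = i
  · subst h; simpa using measurable_fst
  · simp only [Function.update_of_ne h]; fun_prop

/-- Resampling one coordinate does not change a product measure. -/
lemma infinitePi_map_update {ι : Type*} [DecidableEq ι] {X : ι → Type*}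
    [∀ i, MeasurableSpace (X i)] (μ : ∀ i, Measure (X i)) [∀ i, IsProbabilityMeasure (μ i)]
    (i : ι) :
    ((μ i).prod (Measure.infinitePi μ)).map (fun p => Function.update p.2 i p.1) =
      Measure.infinitePi μ := by
  have hm := measurable_update_pair (X := X) i
  refine Measure.eq_infinitePi _ fun s t ht => ?_
  rw [Measure.map_apply hm (.pi s.countable_toSet fun j _ => ht j)]
  by_cases hi : i ∈ s
  · have : (fun p : X i × (∀ j, X j) => Function.update p.2 i p.1) ⁻¹' (Set.pi s t) =
        t i ×ˢ Set.pi (s.erase i : Finset ι) t := by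
      ext p
      simp only [Set.mem_preimage, Set.mem_pi, Set.mem_prod, Finset.mem_coe, Finset.mem_erase]
      constructor
      · refine fun h => ⟨by simpa using h i hi, fun j hj => ?_⟩
        simpa [Function.update_of_ne hj.1] using h j hj.2
      · rintro ⟨h1, h2⟩ j hj
        by_cases hji : j = i
        · subst hji; simpa using h1
        · simpa [Function.update_of_ne hji] using h2 j ⟨hji, hj⟩
    rw [this, Measure.prod_prod, Measure.infinitePi_pi _ fun j _ => ht j,
      Finset.mul_prod_erase s (fun j => μ j (t j)) hi]
  · have : (fun p : X i × (∀ j, X j) => Function.update p.2 i p.1) ⁻¹' (Set.pi s t) =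
        Set.univ ×ˢ Set.pi s t := by
      ext p
      simp only [Set.mem_preimage, Set.mem_pi, Set.mem_prod, Finset.mem_coe, Set.mem_univ,
        true_and]
      refine forall₂_congr fun j hj => ?_
      have hji : j ≠ i := by rintro rfl; exact hi hj
      rw [Function.update_of_ne hji]
    rw [this, Measure.prod_prod, Measure.infinitePi_pi _ fun j _ => ht j, measure_univ, one_mul]

/-- The exponential is the density of N(c,1) with respect to N(0,1). -/
lemma lintegral_gaussianReal_add_const (c : ℝ) {f : ℝ → ℝ≥0∞} (hf : Measurable f) :
    ∫⁻ x, f (x + c) ∂gaussianReal 0 1 =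
      ∫⁻ x, f x * ENNReal.ofReal (Real.exp (c * x - c ^ 2 / 2)) ∂gaussianReal 0 1 := by
  rw [← lintegral_map hf (by fun_prop : Measurable fun x : ℝ => x + c),
    gaussianReal_map_add_const, zero_add,
    gaussianReal_of_var_ne_zero _ one_ne_zero, gaussianReal_of_var_ne_zero _ one_ne_zero,
    lintegral_withDensity_eq_lintegral_mul _ (measurable_gaussianPDF _ _) hf,
    lintegral_withDensity_eq_lintegral_mul _ (measurable_gaussianPDF _ _) (by fun_prop)]
  refine lintegral_congr fun x => ?_
  simp only [Pi.mul_apply, gaussianPDF]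
  rw [mul_comm (f x) (ENNReal.ofReal (Real.exp _)), ← mul_assoc, ← ENNReal.ofReal_mul
    (gaussianPDFReal_nonneg _ _ _)]
  congr 2
  simp only [gaussianPDFReal, mul_assoc, ← Real.exp_add]
  congr 2
  simp
  ring

section CameronMartin

variable {ι : Type*} [DecidableEq ι]

lemma lintegral_infinitePi_gaussian_update (i : ι) (c : ℝ) {f : (ι → ℝ) → ℝ≥0∞}
    (hf : Measurable f) :
    ∫⁻ x, f (x + Pi.single i c) ∂Measure.infinitePi (fun _ : ι => gaussianReal 0 1) =
      ∫⁻ x, f x * ENNReal.ofReal (Real.exp (c * x i - c ^ 2 / 2))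
        ∂Measure.infinitePi (fun _ : ι => gaussianReal 0 1) := by
  have hu := measurable_update_pair (X := fun _ : ι => ℝ) i
  have key : ∀ g : (ι → ℝ) → ℝ≥0∞, Measurable g →
      ∫⁻ x, g x ∂Measure.infinitePi (fun _ : ι => gaussianReal 0 1) =
        ∫⁻ x, ∫⁻ t, g (Function.update x i t) ∂gaussianReal 0 1
          ∂Measure.infinitePi (fun _ : ι => gaussianReal 0 1) := by
    intro g hg
    conv_lhs => rw [← infinitePi_map_update (fun _ : ι => gaussianReal 0 1) i]
    rw [lintegral_map hg hu]
    exact lintegral_prod_symm' _ (hg.comp hu)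
  rw [key (fun x => f (x + (Pi.single i c : ι → ℝ))) (hf.comp (by fun_prop)),
    key (fun x => f x * ENNReal.ofReal (Real.exp (c * x i - c ^ 2 / 2))) (by fun_prop)]
  refine lintegral_congr fun x => ?_
  have hux : Measurable fun t => Function.update x i t := measurable_update x
  have := lintegral_gaussianReal_add_const c (f := fun t => f (Function.update x i t))
    (hf.comp hux)
  refine Eq.trans (lintegral_congr fun t => ?_)
    (this.trans (lintegral_congr fun t => by simp only [Function.update_self]))
  congr 1
  ext j
  by_cases h : j = i
  · subst h; simp
  · simp [h]

/-- Cameron-Martin formula for a shift of finitely many coordinates. -/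
lemma lintegral_infinitePi_gaussian_shift (I : Finset ι) (h : ι → ℝ) {f : (ι → ℝ) → ℝ≥0∞}
    (hf : Measurable f) :
    ∫⁻ x, f (x + ∑ i ∈ I, Pi.single i (h i)) ∂Measure.infinitePi (fun _ : ι => gaussianReal 0 1) =
      ∫⁻ x, f x * ENNReal.ofReal (Real.exp (∑ i ∈ I, (h i * x i - h i ^ 2 / 2)))
        ∂Measure.infinitePi (fun _ : ι => gaussianReal 0 1) := by
  induction I using Finset.induction_on generalizing f with
  | empty => simp
  | insert i I hi ih =>
    have h1 : ∀ x : ι → ℝ, f (x + ∑ j ∈ insert i I, Pi.single j (h j)) =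
        (fun y => f (y + ∑ j ∈ I, Pi.single j (h j))) (x + Pi.single i (h i)) := by
      intro x; rw [Finset.sum_insert hi]; simp only [add_assoc]
    rw [lintegral_congr h1, lintegral_infinitePi_gaussian_update i (h i)
      (f := fun y => f (y + ∑ j ∈ I, Pi.single j (h j))) (hf.comp (by fun_prop))]
    -- The remaining shift leaves coordinate `i` alone, so the density factor of `i` passes through
    -- the induction hypothesis unchanged.
    have h2 : ∀ x : ι → ℝ, (x + ∑ j ∈ I, Pi.single j (h j) : ι → ℝ) i = x i := by
      intro x
      simp only [Pi.add_apply, Finset.sum_apply, add_eq_left]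
      exact Finset.sum_eq_zero fun j hj =>
        Pi.single_eq_of_ne (fun hij => hi (by rw [hij]; exact hj)) _
    have h3 := ih (f := fun x => f x * ENNReal.ofReal (Real.exp (h i * x i - h i ^ 2 / 2)))
      (by fun_prop)
    simp only [h2] at h3
    rw [h3]
    refine lintegral_congr fun x => ?_
    rw [mul_assoc, ← ENNReal.ofReal_mul (Real.exp_pos _).le, ← Real.exp_add, Finset.sum_insert hi]

/-- Cauchy-Schwarz applied to the product of the indicator of `A` and the Cameron-Martin density. -/
lemma infinitePi_gaussian_shift_sq_le_finset (I : Finset ι) (h : ι → ℝ) {A : Set (ι → ℝ)}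
    (hA : MeasurableSet A) :
    (Measure.infinitePi (fun _ : ι => gaussianReal 0 1)
      ((fun x => x + ∑ i ∈ I, Pi.single i (h i)) ⁻¹' A)) ^ 2 ≤
      ENNReal.ofReal (Real.exp (∑ i ∈ I, h i ^ 2)) *
        Measure.infinitePi (fun _ : ι => gaussianReal 0 1) A := by
  set γ := Measure.infinitePi (fun _ : ι => gaussianReal 0 1)
  set ρ : (ι → ℝ) → ℝ≥0∞ :=
    fun x => ENNReal.ofReal (Real.exp (∑ i ∈ I, (h i * x i - h i ^ 2 / 2)))
  have hρ : Measurable ρ := by fun_prop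
  have hind : Measurable (A.indicator (1 : (ι → ℝ) → ℝ≥0∞)) := measurable_one.indicator hA
  have h1 : γ ((fun x => x + ∑ i ∈ I, Pi.single i (h i)) ⁻¹' A) =
      ∫⁻ x, A.indicator 1 x * ρ x ∂γ := by
    rw [← lintegral_infinitePi_gaussian_shift I h hind, ← lintegral_indicator_one
      ((by fun_prop : Measurable fun x : ι → ℝ => x + ∑ i ∈ I, Pi.single i (h i)) hA)]
    rfl
  -- ρ² is exp(∑ h²) times the density of the shift by 2h, and that density has integral 1.
  have h2 : ∫⁻ x, ρ x ^ (2 : ℝ) ∂γ = ENNReal.ofReal (Real.exp (∑ i ∈ I, h i ^ 2)) := by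
    have := lintegral_infinitePi_gaussian_shift I (fun i => 2 * h i)
      (f := fun _ => ENNReal.ofReal (Real.exp (∑ i ∈ I, h i ^ 2))) measurable_const
    simp only [lintegral_const, measure_univ, mul_one] at this
    rw [this]
    refine lintegral_congr fun x => ?_
    rw [ENNReal.ofReal_rpow_of_nonneg (Real.exp_pos _).le (by norm_num),
      ← ENNReal.ofReal_mul (Real.exp_pos _).le, ← Real.exp_mul, ← Real.exp_add,
      ← Finset.sum_add_distrib, Finset.sum_mul]
    congr 3
    ext i
    ring
  have h3 : ∫⁻ x, A.indicator (1 : (ι → ℝ) → ℝ≥0∞) x ^ (2 : ℝ) ∂γ = γ A := by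
    rw [← lintegral_indicator_one hA]
    refine lintegral_congr fun x => ?_
    by_cases hx : x ∈ A <;> simp [hx]
  have h4 := ENNReal.lintegral_mul_le_Lp_mul_Lq γ Real.HolderConjugate.two_two
    hind.aemeasurable hρ.aemeasurable
  simp only [Pi.mul_apply] at h4
  rw [h2, h3, ← h1] at h4
  calc _ ≤ (γ A ^ (1 / 2 : ℝ) *
        ENNReal.ofReal (Real.exp (∑ i ∈ I, h i ^ 2)) ^ (1 / 2 : ℝ)) ^ 2 := by gcongr
    _ = _ := by
      rw [mul_pow, ← ENNReal.rpow_natCast, ← ENNReal.rpow_natCast, ← ENNReal.rpow_mul,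
        ← ENNReal.rpow_mul, mul_comm]
      norm_num

/-- **Cameron-Martin inequality**: shifting an i.i.d. standard Gaussian array by a square-summable
array `h` is an absolutely continuous operation, quantitatively. -/
lemma infinitePi_gaussian_shift_sq_le [Countable ι] (h : ι → ℝ) (hs : Summable fun i => h i ^ 2)
    (A : Set (ι → ℝ)) :
    (Measure.infinitePi (fun _ : ι => gaussianReal 0 1) ((fun x => x + h) ⁻¹' A)) ^ 2 ≤
      ENNReal.ofReal (Real.exp (∑' i, h i ^ 2)) *
        Measure.infinitePi (fun _ : ι => gaussianReal 0 1) A := by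
  set γ := Measure.infinitePi (fun _ : ι => gaussianReal 0 1)
  set K := ENNReal.ofReal (Real.exp (∑' i, h i ^ 2))
  have hK0 : K ≠ 0 := by simp [K, Real.exp_pos]
  have hKt : K ≠ ∞ := ENNReal.ofReal_ne_top
  -- The finite truncations converge to `h` coordinatewise and indicators of open sets are lower
  -- semicontinuous, so Fatou's lemma passes the finite bound to the limit.
  have hopen : ∀ U : Set (ι → ℝ), IsOpen U → (γ ((fun x => x + h) ⁻¹' U)) ^ 2 ≤ K * γ U := by
    intro U hU
    have hlim : Tendsto (fun I : Finset ι => ∑ i ∈ I, Pi.single i (h i)) atTop (𝓝 h) := by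
      refine tendsto_pi_nhds.2 fun j => tendsto_const_nhds.congr' ?_
      filter_upwards [eventually_ge_atTop {j}] with I hI
      rw [Finset.sum_apply, Finset.sum_eq_single j, Pi.single_eq_same]
      · intro i _ hij; exact Pi.single_eq_of_ne hij.symm _
      · intro hj; exact absurd (hI (Finset.mem_singleton_self j)) hj
    have hind : Measurable (U.indicator (1 : (ι → ℝ) → ℝ≥0∞)) :=
      measurable_one.indicator hU.measurableSet
    have hI : ∀ I : Finset ι, ∫⁻ x, U.indicator 1 (x + ∑ i ∈ I, Pi.single i (h i)) ∂γ ≤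
        (K * γ U) ^ (1 / 2 : ℝ) := by
      intro I
      have := infinitePi_gaussian_shift_sq_le_finset I h hU.measurableSet
      have e : ∫⁻ x, U.indicator 1 (x + ∑ i ∈ I, Pi.single i (h i)) ∂γ =
          γ ((fun x => x + ∑ i ∈ I, Pi.single i (h i)) ⁻¹' U) := by
        rw [← lintegral_indicator_one ((by fun_prop :
          Measurable fun x : ι → ℝ => x + ∑ i ∈ I, Pi.single i (h i)) hU.measurableSet)]
        rfl
      rw [e, one_div, ENNReal.le_rpow_inv_iff (by norm_num), ENNReal.rpow_two]
      refine this.trans ?_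
      gcongr
      exact ENNReal.ofReal_le_ofReal (Real.exp_le_exp.2
        (hs.sum_le_tsum I fun i _ => sq_nonneg _))
    have hle : γ ((fun x => x + h) ⁻¹' U) ≤ (K * γ U) ^ (1 / 2 : ℝ) := by
      calc γ ((fun x => x + h) ⁻¹' U)
          = ∫⁻ x, U.indicator 1 (x + h) ∂γ := by
            rw [← lintegral_indicator_one ((by fun_prop :
              Measurable fun x : ι → ℝ => x + h) hU.measurableSet)]
            rfl
        _ ≤ ∫⁻ x, liminf (fun I : Finset ι =>
              U.indicator (1 : (ι → ℝ) → ℝ≥0∞) (x + ∑ i ∈ I, Pi.single i (h i))) atTop ∂γ := by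
            refine lintegral_mono fun x => ?_
            by_cases hx : x + h ∈ U
            · have : ∀ᶠ I : Finset ι in atTop, x + ∑ i ∈ I, Pi.single i (h i) ∈ U :=
                (tendsto_const_nhds.add hlim).eventually (hU.mem_nhds hx)
              rw [liminf_congr (this.mono fun I hI => Set.indicator_of_mem hI _)]
              simp [hx]
            · simp [hx]
        _ ≤ liminf (fun I : Finset ι =>
              ∫⁻ x, U.indicator 1 (x + ∑ i ∈ I, Pi.single i (h i)) ∂γ) atTop :=
            lintegral_liminf_le fun I => hind.comp (by fun_prop)
        _ ≤ liminf (fun I : Finset ι => (K * γ U) ^ (1 / 2 : ℝ)) atTop :=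
            liminf_le_liminf (Eventually.of_forall hI)
        _ = _ := liminf_const _
    calc _ ≤ ((K * γ U) ^ (1 / 2 : ℝ)) ^ 2 := by gcongr
      _ = _ := by rw [← ENNReal.rpow_natCast, ← ENNReal.rpow_mul]; norm_num
  -- Outer regularity: a failure at `A` would persist at some open superset.
  by_contra! hlt
  rw [mul_comm, ← ENNReal.lt_div_iff_mul_lt (Or.inl hK0) (Or.inl hKt)] at hlt
  obtain ⟨U, hAU, hU, hUlt⟩ := Set.exists_isOpen_lt_of_lt _ _ hlt
  rw [ENNReal.lt_div_iff_mul_lt (Or.inl hK0) (Or.inl hKt), mul_comm] at hUlt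
  refine (lt_of_lt_of_le hUlt ?_).not_ge (hopen U hU)
  gcongr

end CameronMartin

/-! ### Tilted Gaussian means and Bayes' formula in the scalar location model. -/

/-- The mean of the law with density proportional to `ψ` with respect to `N(0,1)`. -/
def tiltedMean (ψ : ℝ → ℝ) : ℝ :=
  (∫ z, z * ψ z ∂gaussianReal 0 1) / ∫ z, ψ z ∂gaussianReal 0 1

/-- The posterior mean of a location `θ` with prior density `p` given `x = θ + r ε`,
with `ε ∼ N(0,1)`. -/
def condMean (p : ℝ → ℝ) (r x : ℝ) : ℝ := x + r * tiltedMean fun z => p (x + r * z)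

lemma integrable_gaussianReal_mul_bdd {g ψ : ℝ → ℝ} {C : ℝ} (hg : Integrable g (gaussianReal 0 1))
    (hψ : Measurable ψ) (h0 : ∀ z, 0 ≤ ψ z) (hC : ∀ z, ψ z ≤ C) :
    Integrable (fun z => g z * ψ z) (gaussianReal 0 1) :=
  hg.mul_bdd (c := C) hψ.aestronglyMeasurable
    (Eventually.of_forall fun z => by rw [Real.norm_of_nonneg (h0 z)]; exact hC z)

lemma integrable_bdd_gaussianReal {ψ : ℝ → ℝ} {C : ℝ}
    (hψ : Measurable ψ) (h0 : ∀ z, 0 ≤ ψ z) (hC : ∀ z, ψ z ≤ C) :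
    Integrable ψ (gaussianReal 0 1) := by
  simpa using integrable_gaussianReal_mul_bdd (g := fun _ => 1) (integrable_const _) hψ h0 hC

lemma integrable_id_gaussianReal : Integrable (fun z : ℝ => z) (gaussianReal 0 1) :=
  memLp_one_iff_integrable.1 (memLp_id_gaussianReal 1)

lemma integrable_sq_gaussianReal : Integrable (fun z : ℝ => z ^ 2) (gaussianReal 0 1) :=
  (memLp_id_gaussianReal 2).integrable_sq

lemma integral_sq_gaussianReal : ∫ z : ℝ, z ^ 2 ∂gaussianReal 0 1 = 1 := by
  have := variance_fun_id_gaussianReal (μ := 0) (v := 1)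
  rw [variance_of_integral_eq_zero (by fun_prop) (by simp)] at this
  simpa using this

/-- Clearing the denominator needs no positivity: if the normalizing constant is 0, then ψ vanishes
almost everywhere and both sides are 0. -/
lemma tiltedMean_mul_integral {ψ : ℝ → ℝ} {C : ℝ}
    (hψ : Measurable ψ) (h0 : ∀ z, 0 ≤ ψ z) (hC : ∀ z, ψ z ≤ C) :
    tiltedMean ψ * ∫ z, ψ z ∂gaussianReal 0 1 = ∫ z, z * ψ z ∂gaussianReal 0 1 := by
  by_cases h : ∫ z, ψ z ∂gaussianReal 0 1 = 0
  · have h' := (integral_eq_zero_iff_of_nonneg h0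
      (integrable_bdd_gaussianReal hψ h0 hC)).1 h
    rw [h, mul_zero, integral_eq_zero_of_ae]
    filter_upwards [h'] with z hz
    simp [hz]
  · rw [tiltedMean, div_mul_cancel₀ _ h]

lemma tiltedMean_const_mul {k : ℝ} (hk : k ≠ 0) (ψ : ℝ → ℝ) :
    tiltedMean (fun z => k * ψ z) = tiltedMean ψ := by
  unfold tiltedMean
  simp_rw [mul_left_comm _ k, integral_const_mul]
  exact mul_div_mul_left _ _ hk

/-- The variance of the tilted law is nonnegative. -/
lemma tiltedMean_sq_mul_integral_le {ψ : ℝ → ℝ} {C : ℝ}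
    (hψ : Measurable ψ) (h0 : ∀ z, 0 ≤ ψ z) (hC : ∀ z, ψ z ≤ C) :
    tiltedMean ψ ^ 2 * ∫ z, ψ z ∂gaussianReal 0 1 ≤ ∫ z, z ^ 2 * ψ z ∂gaussianReal 0 1 := by
  set D := tiltedMean ψ with hD
  have h1 := tiltedMean_mul_integral hψ h0 hC
  rw [← hD] at h1
  have i0 := integrable_bdd_gaussianReal hψ h0 hC
  have i1 := integrable_gaussianReal_mul_bdd integrable_id_gaussianReal hψ h0 hC
  have i2 := integrable_gaussianReal_mul_bdd integrable_sq_gaussianReal hψ h0 hC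
  have hpos : 0 ≤ ∫ z, (z - D) ^ 2 * ψ z ∂gaussianReal 0 1 :=
    integral_nonneg fun z => mul_nonneg (sq_nonneg _) (h0 z)
  have : ∫ z, (z - D) ^ 2 * ψ z ∂gaussianReal 0 1 =
      ∫ z, z ^ 2 * ψ z ∂gaussianReal 0 1 - 2 * D * ∫ z, z * ψ z ∂gaussianReal 0 1 +
        D ^ 2 * ∫ z, ψ z ∂gaussianReal 0 1 := by
    rw [← integral_const_mul, ← integral_const_mul, ← integral_sub i2 (i1.const_mul _),
      ← integral_add (f := fun z => z ^ 2 * ψ z - 2 * D * (z * ψ z)) (i2.sub (i1.const_mul _))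
        (i0.const_mul _)]
    congr 1
    ext z
    ring
  rw [this, ← h1] at hpos
  nlinarith

lemma measurable_integral_gaussianReal {f : ℝ → ℝ → ℝ} (hf : Measurable (Function.uncurry f)) :
    Measurable fun x => ∫ z, f x z ∂gaussianReal 0 1 :=
  (hf.stronglyMeasurable.integral_prod_right (ν := gaussianReal 0 1)).measurable

lemma measurable_tiltedMean {f : ℝ → ℝ → ℝ} (hf : Measurable (Function.uncurry f)) :
    Measurable fun x => tiltedMean (f x) := by
  refine Measurable.div (measurable_integral_gaussianReal ?_) (measurable_integral_gaussianReal hf)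
  exact measurable_snd.mul hf

lemma measurable_condMean {p : ℝ → ℝ} (hp : Measurable p) (r : ℝ) : Measurable (condMean p r) :=
  measurable_id.add ((measurable_tiltedMean
    (f := fun x z => p (x + r * z)) (hp.comp (by fun_prop))).const_mul r)

/-- By symmetry of the noise, the integral on the left is the marginal density of the observation at
`x`. This is Bayes' formula before normalization. -/
lemma condMean_mul_integral {p : ℝ → ℝ} {C : ℝ} (hp : Measurable p) (h0 : ∀ x, 0 ≤ p x)
    (hC : ∀ x, p x ≤ C) (r x : ℝ) :
    condMean p r x * ∫ z, p (x + r * z) ∂gaussianReal 0 1 =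
      ∫ z, p (x + r * z) * (x + r * z) ∂gaussianReal 0 1 := by
  have hm : Measurable fun z => p (x + r * z) := hp.comp (by fun_prop)
  have i0 := integrable_bdd_gaussianReal hm (fun _ => h0 _) fun _ => hC _
  have i1 := integrable_gaussianReal_mul_bdd integrable_id_gaussianReal hm (fun _ => h0 _)
    fun _ => hC _
  rw [condMean, add_mul, mul_assoc, tiltedMean_mul_integral hm (fun _ => h0 _) fun _ => hC _,
    ← integral_const_mul, ← integral_const_mul, ← integral_add (i0.const_mul _) (i1.const_mul _)]
  congr 1
  ext z
  ring

/-- `N(0,1) ⊗ λ` is invariant under `(e,t) ↦ (-e, t + r e)`. -/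
lemma measurePreserving_neg_add_mul (r : ℝ) :
    MeasurePreserving (fun q : ℝ × ℝ => (-q.1, q.2 + r * q.1))
      ((gaussianReal 0 1).prod volume) ((gaussianReal 0 1).prod volume) := by
  have h1 : MeasurePreserving (fun e : ℝ => -e) (gaussianReal 0 1) (gaussianReal 0 1) :=
    ⟨measurable_neg, by rw [gaussianReal_map_neg, neg_zero]⟩
  exact h1.skew_product (g := fun e t => t + r * e) (by fun_prop)
    (Eventually.of_forall fun e => (measurePreserving_add_right volume (r * e)).map_eq)

lemma measurableEmbedding_neg_add_mul (r : ℝ) :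
    MeasurableEmbedding fun q : ℝ × ℝ => (-q.1, q.2 + r * q.1) := by
  have hinv : Function.Involutive fun q : ℝ × ℝ => (-q.1, q.2 + r * q.1) := fun q => by simp
  exact (MeasurableEquiv.ofInvolutive _ hinv (by fun_prop)).measurableEmbedding

/-- The map (e,t) ↦ (-e, t + re) is an involution that exchanges parameter and observation. After it
the observation is an integration variable, and the prior density appears as the likelihood-weighted
factor. -/
lemma integral_prod_withDensity_comp_add {p : ℝ → ℝ} (hp : Measurable p) (h0 : ∀ x, 0 ≤ p x)
    (r : ℝ) (F : ℝ → ℝ → ℝ) :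
    ∫ q, F q.2 (q.2 + r * q.1)
      ∂(gaussianReal 0 1).prod (volume.withDensity fun x => ENNReal.ofReal (p x)) =
    ∫ q, p (q.2 + r * q.1) * F (q.2 + r * q.1) q.2 ∂(gaussianReal 0 1).prod volume := by
  rw [prod_withDensity_right (by fun_prop), integral_withDensity_eq_integral_toReal_smul
    (by fun_prop) (by simp), ← (measurePreserving_neg_add_mul r).integral_comp
    (measurableEmbedding_neg_add_mul r)
    (fun q : ℝ × ℝ => p (q.2 + r * q.1) * F (q.2 + r * q.1) q.2)]
  congr 1
  ext q
  simp [ENNReal.toReal_ofReal (h0 _)]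

lemma integrable_prod_withDensity_comp_add_iff {p : ℝ → ℝ} (hp : Measurable p)
    (h0 : ∀ x, 0 ≤ p x) (r : ℝ) (F : ℝ → ℝ → ℝ) :
    Integrable (fun q : ℝ × ℝ => F q.2 (q.2 + r * q.1))
      ((gaussianReal 0 1).prod (volume.withDensity fun x => ENNReal.ofReal (p x))) ↔
    Integrable (fun q : ℝ × ℝ => p (q.2 + r * q.1) * F (q.2 + r * q.1) q.2)
      ((gaussianReal 0 1).prod volume) := by
  rw [prod_withDensity_right (by fun_prop), integrable_withDensity_iff_integrable_smul'
    (by fun_prop) (by simp), ← (measurePreserving_neg_add_mul r).integrable_comp_emb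
    (measurableEmbedding_neg_add_mul r)]
  refine iff_of_eq (congrArg (fun f => Integrable f _) ?_)
  ext q
  simp [ENNReal.toReal_ofReal (h0 _)]

/-- Conditional expectation contracts L¹: after exchanging parameter and observation, |`condMean`|
times the marginal density is the absolute value of a partial integral of an integrable function. -/
lemma integrable_condMean {p : ℝ → ℝ} {C : ℝ} (hp : Measurable p) (h0 : ∀ x, 0 ≤ p x)
    (hC : ∀ x, p x ≤ C)
    (hmass : Integrable (fun x => x) (volume.withDensity fun x => ENNReal.ofReal (p x)))
    (r : ℝ) :
    Integrable (fun q : ℝ × ℝ => condMean p r (q.2 + r * q.1))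
      ((gaussianReal 0 1).prod (volume.withDensity fun x => ENNReal.ofReal (p x))) := by
  have h1 : Integrable (fun q : ℝ × ℝ => q.2)
      ((gaussianReal 0 1).prod (volume.withDensity fun x => ENNReal.ofReal (p x))) :=
    hmass.comp_snd _
  have h2 := (integrable_prod_withDensity_comp_add_iff hp h0 r fun t _ => t).1 h1
  have h3 := h2.integral_prod_right
  refine (integrable_prod_withDensity_comp_add_iff hp h0 r fun _ x => condMean p r x).2 ?_
  have hm := measurable_condMean hp r
  refine (integrable_prod_iff' (by fun_prop)).2 ⟨Eventually.of_forall fun x => ?_, ?_⟩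
  · exact (integrable_bdd_gaussianReal (ψ := fun z => p (x + r * z)) (hp.comp (by fun_prop))
      (fun _ => h0 _) fun _ => hC _).mul_const (condMean p r x)
  · refine h3.norm.congr (Eventually.of_forall fun x => ?_)
    simp only [norm_mul, integral_mul_const]
    rw [← condMean_mul_integral hp h0 hC, norm_mul, mul_comm]
    congr 1
    rw [Real.norm_of_nonneg (integral_nonneg fun z => h0 _)]
    exact integral_congr_ae (Eventually.of_forall fun z => (Real.norm_of_nonneg (h0 _)).symm)

/-- The Bayes formula for the posterior mean in the scalar Gaussian location model. -/
lemma integral_mul_indicator_eq_condMean {p : ℝ → ℝ} {C : ℝ} (hp : Measurable p)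
    (h0 : ∀ x, 0 ≤ p x) (hC : ∀ x, p x ≤ C)
    (hmass : Integrable (fun x => x) (volume.withDensity fun x => ENNReal.ofReal (p x)))
    (r : ℝ) {A : Set ℝ} (hA : MeasurableSet A) :
    ∫ q, A.indicator (fun _ => q.2) (q.2 + r * q.1)
      ∂(gaussianReal 0 1).prod (volume.withDensity fun x => ENNReal.ofReal (p x)) =
    ∫ q, A.indicator (condMean p r) (q.2 + r * q.1)
      ∂(gaussianReal 0 1).prod (volume.withDensity fun x => ENNReal.ofReal (p x)) := by
  have hmeas : Measurable fun q : ℝ × ℝ => q.2 + r * q.1 := by fun_prop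
  have i1 : Integrable (fun q : ℝ × ℝ => A.indicator (fun _ => q.2) (q.2 + r * q.1))
      ((gaussianReal 0 1).prod (volume.withDensity fun x => ENNReal.ofReal (p x))) :=
    ((hmass.comp_snd _).indicator (hmeas hA)).congr (Eventually.of_forall fun q => rfl)
  have i2 : Integrable (fun q : ℝ × ℝ => A.indicator (condMean p r) (q.2 + r * q.1))
      ((gaussianReal 0 1).prod (volume.withDensity fun x => ENNReal.ofReal (p x))) :=
    ((integrable_condMean hp h0 hC hmass r).indicator (hmeas hA)).congr
      (Eventually.of_forall fun q => rfl)
  rw [integral_prod_withDensity_comp_add hp h0 r fun t x => A.indicator (fun _ => t) x,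
    integral_prod_withDensity_comp_add hp h0 r fun _ x => A.indicator (condMean p r) x,
    integral_prod_symm _ ((integrable_prod_withDensity_comp_add_iff hp h0 r
      fun t x => A.indicator (fun _ => t) x).1 i1),
    integral_prod_symm _ ((integrable_prod_withDensity_comp_add_iff hp h0 r
      fun _ x => A.indicator (condMean p r) x).1 i2)]
  congr 1
  ext x
  by_cases hx : x ∈ A
  · simp only [Set.indicator_of_mem hx]
    rw [integral_mul_const, ← condMean_mul_integral hp h0 hC, mul_comm]
  · simp [hx]

/-! ### Uniform bounds and limits for the scalar tilted mean. -/

lemma integrable_exp_neg_mul_abs {a : ℝ} (ha : 0 < a) :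
    Integrable fun x : ℝ => Real.exp (-(a * |x|)) := by
  refine (integrable_inv_one_add_sq.const_mul (1 + 2 / a ^ 2)).mono'
    (by fun_prop) (Eventually.of_forall fun x => ?_)
  rw [Real.norm_of_nonneg (Real.exp_pos _).le, Real.exp_neg, ← div_eq_mul_inv,
    inv_le_comm₀ (Real.exp_pos _) (by positivity), inv_div, div_le_iff₀ (by positivity)]
  have h := Real.quadratic_le_exp_of_nonneg (x := a * |x|) (by positivity)
  have h' : 1 + a ^ 2 * x ^ 2 / 2 ≤ Real.exp (a * |x|) := by
    have : (a * |x|) ^ 2 = a ^ 2 * x ^ 2 := by rw [mul_pow, sq_abs]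
    have : 0 ≤ a * |x| := by positivity
    linarith
  calc 1 + x ^ 2 ≤ (1 + a ^ 2 * x ^ 2 / 2) * (1 + 2 / a ^ 2) := by
        have : (1 + a ^ 2 * x ^ 2 / 2) * (1 + 2 / a ^ 2) =
          1 + x ^ 2 + (a ^ 2 * x ^ 2 / 2 + 2 / a ^ 2) := by field_simp; ring
        rw [this]
        have : 0 ≤ a ^ 2 * x ^ 2 / 2 + 2 / a ^ 2 := by positivity
        linarith
    _ ≤ _ := by gcongr

lemma gaussianPDFReal_zero_one (x : ℝ) :
    gaussianPDFReal 0 1 x = (√(2 * Real.pi))⁻¹ * Real.exp (-x ^ 2 / 2) := by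
  simp [gaussianPDFReal]

lemma le_integral_gaussianReal_of_le_on_Ioo {ψ : ℝ → ℝ} {C k lo hi : ℝ}
    (hψ : Measurable ψ) (h0 : ∀ z, 0 ≤ ψ z) (hC : ∀ z, ψ z ≤ C) (hlh : lo ≤ hi)
    (hk : ∀ z ∈ Set.Ioo lo hi, k ≤ gaussianPDFReal 0 1 z * ψ z) :
    k * (hi - lo) ≤ ∫ z, ψ z ∂gaussianReal 0 1 := by
  rw [integral_gaussianReal_eq_integral_smul one_ne_zero]
  have hmass : Integrable fun z => gaussianPDFReal 0 1 z • ψ z := by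
    refine (integrable_gaussianPDFReal 0 1).mul_bdd (c := C) hψ.aestronglyMeasurable
      (Eventually.of_forall fun z => ?_)
    rw [Real.norm_of_nonneg (h0 z)]; exact hC z
  have hnn : ∀ z, 0 ≤ gaussianPDFReal 0 1 z • ψ z :=
    fun z => mul_nonneg (gaussianPDFReal_nonneg _ _ _) (h0 z)
  calc k * (hi - lo) = ∫ _ in Set.Ioo lo hi, k := by
        simp [Real.volume_real_Ioo_of_le hlh, mul_comm]
    _ ≤ ∫ z in Set.Ioo lo hi, gaussianPDFReal 0 1 z • ψ z :=
        setIntegral_mono_on (by simp) hmass.integrableOn measurableSet_Ioo hk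
    _ ≤ _ := setIntegral_le_integral hmass (Eventually.of_forall hnn)

section Bounds

variable {φ : ℝ → ℝ} {M τ c C t₀ : ℝ}

/-- Lower bound for the normalizing constant of a posterior. -/
lemma le_integral_of_le_on_Ioo (hφ : Measurable φ) (h0 : ∀ x, 0 ≤ φ x) (hC : ∀ x, φ x ≤ C)
    (hc : 0 < c) (hge : ∀ x ∈ Set.Ioo (-τ) τ, c ≤ φ x) (ht₀ : |t₀| ≤ M) {s b : ℝ} (hs : 0 < s)
    (hb : 0 < b) (hbs : b ≤ s * (τ - M)) (ε : ℝ) :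
    c * (b / 2) * (Real.exp (b * |ε| / 2 - b ^ 2 / 2) * gaussianPDFReal 0 1 ε) ≤
      ∫ z, φ (t₀ + (ε + z) / s) ∂gaussianReal 0 1 := by
  -- Here u = ε + z ranges over a window of length b/2 on the side of 0 where ε lies. The bound on
  -- `b` keeps t₀ + u/s inside (-τ, τ), and the cross term uε ≥ b|ε|/2 of the Gaussian exponent
  -- supplies the factor exp(b|ε|/2).
  have key : ∀ u : ℝ, b / 2 < |u| → |u| < b → u * ε = |u| * |ε| →
      c * (Real.exp (b * |ε| / 2 - b ^ 2 / 2) * gaussianPDFReal 0 1 ε) ≤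
        gaussianPDFReal 0 1 (u - ε) * φ (t₀ + (ε + (u - ε)) / s) := by
    intro u hu1 hu2 hu
    rw [mul_comm]
    refine mul_le_mul ?_ (hge _ ?_) hc.le (gaussianPDFReal_nonneg _ _ _)
    · rw [gaussianPDFReal_zero_one, gaussianPDFReal_zero_one, mul_left_comm, ← Real.exp_add]
      gcongr
      have h1 : u ^ 2 ≤ b ^ 2 := by rw [← sq_abs u]; gcongr
      have h2 : b / 2 * |ε| ≤ |u| * |ε| := by gcongr
      nlinarith
    · rw [add_sub_cancel, Set.mem_Ioo, ← abs_lt]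
      have : |u / s| < τ - M := by
        rw [abs_div, abs_of_pos hs, div_lt_iff₀ hs]
        linarith
      calc |t₀ + u / s| ≤ |t₀| + |u / s| := abs_add_le _ _
        _ < τ := by linarith
  have hm : Measurable fun z => φ (t₀ + (ε + z) / s) := hφ.comp (by fun_prop)
  rcases le_total 0 ε with hε | hε
  · have := le_integral_gaussianReal_of_le_on_Ioo hm (fun _ => h0 _) (fun _ => hC _)
      (lo := b / 2 - ε) (hi := b - ε) (by linarith)
      (k := c * (Real.exp (b * |ε| / 2 - b ^ 2 / 2) * gaussianPDFReal 0 1 ε)) (fun z hz => by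
        have hz1 := hz.1
        have hz2 := hz.2
        have hpos : 0 < z + ε := by linarith
        have := key (z + ε) (by rw [abs_of_pos hpos]; linarith) (by rw [abs_of_pos hpos]; linarith)
          (by rw [abs_of_pos hpos, abs_of_nonneg hε])
        simpa using this)
    refine le_trans (le_of_eq ?_) this
    ring
  · have := le_integral_gaussianReal_of_le_on_Ioo hm (fun _ => h0 _) (fun _ => hC _)
      (lo := -b - ε) (hi := -(b / 2) - ε) (by linarith)
      (k := c * (Real.exp (b * |ε| / 2 - b ^ 2 / 2) * gaussianPDFReal 0 1 ε)) (fun z hz => by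
        have hz1 := hz.1
        have hz2 := hz.2
        have hneg : z + ε < 0 := by linarith
        have := key (z + ε) (by rw [abs_of_neg hneg]; linarith) (by rw [abs_of_neg hneg]; linarith)
          (by rw [abs_of_neg hneg, abs_of_nonpos hε]; ring)
        simpa using this)
    refine le_trans (le_of_eq ?_) this
    ring

lemma lintegral_gaussianReal_zero_one {f : ℝ → ℝ≥0∞} (hf : Measurable f) :
    ∫⁻ x, f x ∂gaussianReal 0 1 = ∫⁻ x, ENNReal.ofReal (gaussianPDFReal 0 1 x) * f x := by
  rw [gaussianReal_of_var_ne_zero _ one_ne_zero,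
    lintegral_withDensity_eq_lintegral_mul _ (measurable_gaussianPDF _ _) hf]
  rfl

lemma lintegral_comp_add_div (hφ : Measurable φ) (t₀ z : ℝ) {s : ℝ} (hs : 0 < s) :
    ∫⁻ ε, ENNReal.ofReal (φ (t₀ + (ε + z) / s)) =
      ENNReal.ofReal s * ∫⁻ x, ENNReal.ofReal (φ x) := by
  have h1 := lintegral_add_right_eq_self (μ := volume)
    (fun ε : ℝ => ENNReal.ofReal (φ (t₀ + ε / s))) z
  rw [h1]
  have h2 := lintegral_add_left_eq_self (μ := volume) (fun x => ENNReal.ofReal (φ x)) t₀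
  rw [← h2]
  have h3 : ∫⁻ x, ENNReal.ofReal (φ (t₀ + x / s)) =
      ∫⁻ y, ENNReal.ofReal (φ (t₀ + y)) ∂(volume.map fun x => s⁻¹ * x) := by
    rw [lintegral_map (by fun_prop) (by fun_prop)]
    simp_rw [div_eq_inv_mul]
  rw [h3, Real.map_volume_mul_left (inv_ne_zero hs.ne'), lintegral_smul_measure, inv_inv,
    abs_of_pos hs, smul_eq_mul]

/-- Second moment bound when the prior scale is small compared to the noise level. -/
lemma lintegral_tiltedMean_sq_le_of_le_one (hφ : Measurable φ) (h0 : ∀ x, 0 ≤ φ x)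
    (hmass : ∫⁻ x, ENNReal.ofReal (φ x) = 1) (hC : ∀ x, φ x ≤ C)
    (hc : 0 < c) (hge : ∀ x ∈ Set.Ioo (-τ) τ, c ≤ φ x) (ht₀ : |t₀| ≤ M) (hM : M < τ)
    {s : ℝ} (hs : 0 < s) (hs1 : s ≤ 1) :
    ∫⁻ ε, ENNReal.ofReal (tiltedMean (fun z => φ (t₀ + (ε + z) / s)) ^ 2) ∂gaussianReal 0 1 ≤
      ENNReal.ofReal ((c * ((τ - M) / 2) * Real.exp (-(τ - M) ^ 2 / 2))⁻¹) := by
  set ρ := τ - M with hρ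
  have hρ0 : 0 < ρ := by rw [hρ]; linarith
  set κ := c * (ρ / 2) * Real.exp (-ρ ^ 2 / 2) with hκ
  have hκ0 : 0 < κ := by positivity
  have hmφ : Measurable (Function.uncurry fun ε z : ℝ => φ (t₀ + (ε + z) / s)) :=
    hφ.comp (by fun_prop)
  have hmD : Measurable fun ε => tiltedMean (fun z => φ (t₀ + (ε + z) / s)) :=
    measurable_tiltedMean hmφ
  have hm2 : Measurable fun ε => ∫ z, z ^ 2 * φ (t₀ + (ε + z) / s) ∂gaussianReal 0 1 :=
    measurable_integral_gaussianReal (f := fun ε z => z ^ 2 * φ (t₀ + (ε + z) / s))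
      ((measurable_snd.pow_const 2).mul hmφ)
  rw [lintegral_gaussianReal_zero_one (by fun_prop)]
  -- The Gaussian weight of ε cancels against the lower bound on the normalizing constant. What
  -- remains is integrated in ε against Lebesgue measure, where it yields s ∫ φ = s and removes the
  -- 1/s.
  have hpt : ∀ ε, gaussianPDFReal 0 1 ε * tiltedMean (fun z => φ (t₀ + (ε + z) / s)) ^ 2 ≤
      (κ * s)⁻¹ * ∫ z, z ^ 2 * φ (t₀ + (ε + z) / s) ∂gaussianReal 0 1 := by
    intro ε
    have hm : Measurable fun z => φ (t₀ + (ε + z) / s) := hφ.comp (by fun_prop)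
    have h1 := tiltedMean_sq_mul_integral_le hm (fun _ => h0 _) fun _ => hC _
    -- The largest admissible window is b = sρ; since s ≤ 1, the loss exp(-b²/2) is at worst
    -- exp(-ρ²/2).
    have h2 := le_integral_of_le_on_Ioo hφ h0 hC hc hge ht₀ hs (mul_pos hs hρ0) le_rfl ε
    have h3 : κ * s * gaussianPDFReal 0 1 ε ≤
        ∫ z, φ (t₀ + (ε + z) / s) ∂gaussianReal 0 1 := by
      refine le_trans ?_ h2
      have : κ * s * gaussianPDFReal 0 1 ε =
        c * (s * ρ / 2) * (Real.exp (-ρ ^ 2 / 2) * gaussianPDFReal 0 1 ε) := by rw [hκ]; ring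
      rw [this]
      have hg := gaussianPDFReal_nonneg 0 1 ε
      gcongr
      have h4 : 0 ≤ s * ρ * |ε| / 2 := by positivity
      have h5 : (s * ρ) ^ 2 ≤ ρ ^ 2 := by
        gcongr
        nlinarith
      linarith
    rw [le_inv_mul_iff₀ (by positivity)]
    refine le_trans ?_ h1
    rw [← mul_assoc, mul_comm]
    gcongr
  calc _ ≤ ∫⁻ ε, ENNReal.ofReal (κ * s)⁻¹ *
        ∫⁻ z, ENNReal.ofReal (z ^ 2) * ENNReal.ofReal (φ (t₀ + (ε + z) / s))
          ∂gaussianReal 0 1 := by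
        refine lintegral_mono fun ε => ?_
        rw [← ENNReal.ofReal_mul (gaussianPDFReal_nonneg _ _ _)]
        refine (ENNReal.ofReal_le_ofReal (hpt ε)).trans ?_
        rw [ENNReal.ofReal_mul (by positivity)]
        gcongr
        rw [ofReal_integral_eq_lintegral_ofReal]
        · simp_rw [ENNReal.ofReal_mul (sq_nonneg _)]; rfl
        · exact integrable_gaussianReal_mul_bdd integrable_sq_gaussianReal
            (hφ.comp (by fun_prop)) (fun _ => h0 _) fun _ => hC _
        · exact Eventually.of_forall fun z => mul_nonneg (sq_nonneg _) (h0 _)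
    _ = ENNReal.ofReal (κ * s)⁻¹ * ∫⁻ z, (∫⁻ ε, ENNReal.ofReal (z ^ 2) *
          ENNReal.ofReal (φ (t₀ + (ε + z) / s))) ∂gaussianReal 0 1 := by
        rw [lintegral_const_mul' _ _ ENNReal.ofReal_ne_top, lintegral_lintegral_swap]
        exact ((measurable_snd.pow_const 2).ennreal_ofReal.mul hmφ.ennreal_ofReal).aemeasurable
    _ = ENNReal.ofReal (κ * s)⁻¹ * ∫⁻ z, ENNReal.ofReal (z ^ 2) * ENNReal.ofReal s
          ∂gaussianReal 0 1 := by
        congr 1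
        refine lintegral_congr fun z => ?_
        rw [lintegral_const_mul' _ _ ENNReal.ofReal_ne_top, lintegral_comp_add_div hφ t₀ z hs,
          hmass, mul_one]
    _ = ENNReal.ofReal κ⁻¹ := by
        rw [lintegral_mul_const' _ _ ENNReal.ofReal_ne_top, ← ofReal_integral_eq_lintegral_ofReal
          integrable_sq_gaussianReal (Eventually.of_forall fun z => sq_nonneg z),
          integral_sq_gaussianReal, ENNReal.ofReal_one, one_mul,
          ← ENNReal.ofReal_mul (by positivity)]
        congr 1
        field_simp

/-- Pointwise bound when the prior scale is large compared to the noise level. -/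
lemma gaussianPDFReal_mul_tiltedMean_sq_le (hφ : Measurable φ) (h0 : ∀ x, 0 ≤ φ x)
    (hC : ∀ x, φ x ≤ C)
    (hc : 0 < c) (hge : ∀ x ∈ Set.Ioo (-τ) τ, c ≤ φ x) (ht₀ : |t₀| ≤ M) (hM : M < τ)
    {s : ℝ} (hs1 : 1 ≤ s) (ε : ℝ) :
    gaussianPDFReal 0 1 ε * tiltedMean (fun z => φ (t₀ + (ε + z) / s)) ^ 2 ≤
      C * (c * ((τ - M) / 2) * Real.exp (-(τ - M) ^ 2 / 2))⁻¹ *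
        Real.exp (-((τ - M) / 2 * |ε|)) := by
  set ρ := τ - M with hρ
  have hρ0 : 0 < ρ := by rw [hρ]; linarith
  set κ := c * (ρ / 2) * Real.exp (-ρ ^ 2 / 2) with hκ
  have hκ0 : 0 < κ := by positivity
  have hm : Measurable fun z => φ (t₀ + (ε + z) / s) := hφ.comp (by fun_prop)
  have h1 := tiltedMean_sq_mul_integral_le hm (fun _ => h0 _) fun _ => hC _
  -- For s ≥ 1 the window b = ρ is admissible whatever s is. The gain exp(ρ|ε|/2) then becomes an
  -- integrable majorant free of s.
  have h2 := le_integral_of_le_on_Ioo hφ h0 hC hc hge ht₀ (by linarith : 0 < s) hρ0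
    (by nlinarith) ε
  have h3 : ∫ z, z ^ 2 * φ (t₀ + (ε + z) / s) ∂gaussianReal 0 1 ≤ C := by
    calc _ ≤ ∫ z, z ^ 2 * C ∂gaussianReal 0 1 := by
          refine integral_mono (integrable_gaussianReal_mul_bdd integrable_sq_gaussianReal
            hm (fun _ => h0 _) fun _ => hC _) (integrable_sq_gaussianReal.mul_const _) fun z => ?_
          exact mul_le_mul_of_nonneg_left (hC _) (sq_nonneg z)
      _ = C := by rw [integral_mul_const, integral_sq_gaussianReal, one_mul]
  have h4 : κ * Real.exp (ρ / 2 * |ε|) * gaussianPDFReal 0 1 ε ≤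
      ∫ z, φ (t₀ + (ε + z) / s) ∂gaussianReal 0 1 := by
    refine le_trans (le_of_eq ?_) h2
    rw [hκ, mul_assoc (c * (ρ / 2)), ← Real.exp_add, mul_assoc]
    congr 3
    ring
  have h5 : κ * Real.exp (ρ / 2 * |ε|) *
      (gaussianPDFReal 0 1 ε * tiltedMean (fun z => φ (t₀ + (ε + z) / s)) ^ 2) ≤ C := by
    refine le_trans ?_ (h1.trans h3)
    rw [← mul_assoc, mul_comm]
    gcongr
  rw [mul_assoc, Real.exp_neg, ← mul_inv, mul_comm C, le_inv_mul_iff₀ (by positivity)]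
  exact h5

/-- The cases s ≤ 1 and s ≥ 1 are bounded separately. Uniformity over all s > 0 matters because at a
given n the ratios σ_l √n need not be bounded away from 0. -/
lemma exists_lintegral_tiltedMean_sq_le (hφ : Measurable φ) (h0 : ∀ x, 0 ≤ φ x)
    (hmass : ∫⁻ x, ENNReal.ofReal (φ x) = 1) (hC : ∀ x, φ x ≤ C)
    (hc : 0 < c) (hge : ∀ x ∈ Set.Ioo (-τ) τ, c ≤ φ x) (hM : M < τ) :
    ∃ K : ℝ, 0 ≤ K ∧ ∀ t₀ s : ℝ, |t₀| ≤ M → 0 < s →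
      ∫⁻ ε, ENNReal.ofReal (tiltedMean (fun z => φ (t₀ + (ε + z) / s)) ^ 2) ∂gaussianReal 0 1 ≤
        ENNReal.ofReal K := by
  have hρ0 : 0 < τ - M := by linarith
  set κ := c * ((τ - M) / 2) * Real.exp (-(τ - M) ^ 2 / 2) with hκ
  have hκ0 : 0 < κ := by positivity
  set K₂ := ∫ ε : ℝ, C * κ⁻¹ * Real.exp (-((τ - M) / 2 * |ε|))
  refine ⟨max κ⁻¹ K₂, (inv_pos.2 hκ0).le.trans (le_max_left _ _), fun t₀ s ht₀ hs => ?_⟩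
  rcases le_total s 1 with hs1 | hs1
  · exact (lintegral_tiltedMean_sq_le_of_le_one hφ h0 hmass hC hc hge ht₀ hM hs hs1).trans
      (ENNReal.ofReal_le_ofReal (le_max_left _ _))
  · have hmD : Measurable fun ε => tiltedMean (fun z => φ (t₀ + (ε + z) / s)) :=
      measurable_tiltedMean (f := fun ε z : ℝ => φ (t₀ + (ε + z) / s)) (hφ.comp (by fun_prop))
    have hC0 : 0 ≤ C := (h0 0).trans (hC 0)
    rw [lintegral_gaussianReal_zero_one (by fun_prop)]
    refine le_trans ?_ (ENNReal.ofReal_le_ofReal (le_max_right κ⁻¹ K₂))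
    rw [ofReal_integral_eq_lintegral_ofReal
      ((integrable_exp_neg_mul_abs (half_pos hρ0)).const_mul _)
      (Eventually.of_forall fun ε => by positivity)]
    refine lintegral_mono fun ε => ?_
    rw [← ENNReal.ofReal_mul (gaussianPDFReal_nonneg _ _ _)]
    exact ENNReal.ofReal_le_ofReal
      (gaussianPDFReal_mul_tiltedMean_sq_le hφ h0 hC hc hge ht₀ hM hs1 ε)

/-- The tilt flattens to the nonzero constant φ(t₀), and a constant tilt gives the mean of N(0,1).
-/
lemma tendsto_tiltedMean_zero (hφ : Measurable φ) (h0 : ∀ x, 0 ≤ φ x) (hC : ∀ x, φ x ≤ C)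
    (hpos : φ t₀ ≠ 0) (hcont : ContinuousAt φ t₀) {s : ℕ → ℝ} (hs : Tendsto s atTop atTop)
    (ε : ℝ) :
    Tendsto (fun n => tiltedMean (fun z => φ (t₀ + (ε + z) / s n))) atTop (𝓝 0) := by
  have hlim : ∀ z : ℝ, Tendsto (fun n => φ (t₀ + (ε + z) / s n)) atTop (𝓝 (φ t₀)) := by
    intro z
    refine hcont.tendsto.comp ?_
    simpa using (tendsto_const_nhds (x := t₀)).add (hs.const_div_atTop (ε + z))
  have hm : ∀ n, Measurable fun z => φ (t₀ + (ε + z) / s n) := fun n => hφ.comp (by fun_prop)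
  have hnorm : ∀ x, ‖φ x‖ ≤ C := fun x => by rw [Real.norm_of_nonneg (h0 x)]; exact hC x
  have h1 : Tendsto (fun n => ∫ z, z * φ (t₀ + (ε + z) / s n) ∂gaussianReal 0 1) atTop
      (𝓝 (∫ z, z * φ t₀ ∂gaussianReal 0 1)) := by
    refine tendsto_integral_of_dominated_convergence (fun z => |z| * C)
      (fun n => (measurable_id.mul (hm n)).aestronglyMeasurable)
      (integrable_id_gaussianReal.abs.mul_const C)
      (fun n => Eventually.of_forall fun z => ?_)
      (Eventually.of_forall fun z => (hlim z).const_mul z)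
    rw [norm_mul, Real.norm_eq_abs]
    exact mul_le_mul_of_nonneg_left (hnorm _) (abs_nonneg z)
  have h2 : Tendsto (fun n => ∫ z, φ (t₀ + (ε + z) / s n) ∂gaussianReal 0 1) atTop
      (𝓝 (∫ _, φ t₀ ∂gaussianReal 0 1)) :=
    tendsto_integral_of_dominated_convergence (fun _ => C)
      (fun n => (hm n).aestronglyMeasurable) (integrable_const _)
      (fun n => Eventually.of_forall fun z => hnorm _) (Eventually.of_forall hlim)
  have h3 := h1.div h2 (by simpa using hpos)
  simp only [integral_mul_const, integral_id_gaussianReal, zero_mul, zero_div] at h3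
  exact h3

/-- Dominated convergence in ε: the exponential majorant for s ≥ 1 applies to all large `n`. -/
lemma tendsto_lintegral_tiltedMean_sq (hφ : Measurable φ) (h0 : ∀ x, 0 ≤ φ x)
    (hC : ∀ x, φ x ≤ C)
    (hc : 0 < c) (hge : ∀ x ∈ Set.Ioo (-τ) τ, c ≤ φ x) (ht₀ : |t₀| ≤ M) (hM : M < τ)
    (hcont : ContinuousAt φ t₀) {s : ℕ → ℝ} (hs : Tendsto s atTop atTop) :
    Tendsto (fun n => ∫⁻ ε, ENNReal.ofReal
      (tiltedMean (fun z => φ (t₀ + (ε + z) / s n)) ^ 2) ∂gaussianReal 0 1) atTop (𝓝 0) := by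
  have hρ0 : 0 < τ - M := by linarith
  have hpos : φ t₀ ≠ 0 :=
    (hc.trans_le (hge t₀ (abs_lt.1 (ht₀.trans_lt hM)))).ne'
  have hmD : ∀ n, Measurable fun ε => tiltedMean (fun z => φ (t₀ + (ε + z) / s n)) := fun n =>
    measurable_tiltedMean (f := fun ε z : ℝ => φ (t₀ + (ε + z) / s n)) (hφ.comp (by fun_prop))
  simp_rw [fun n => lintegral_gaussianReal_zero_one
    (f := fun ε => ENNReal.ofReal (tiltedMean (fun z => φ (t₀ + (ε + z) / s n)) ^ 2))
    ((hmD n).pow_const 2).ennreal_ofReal]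
  have hbd := (integrable_exp_neg_mul_abs (half_pos hρ0)).const_mul
    (C * (c * ((τ - M) / 2) * Real.exp (-(τ - M) ^ 2 / 2))⁻¹)
  have h := tendsto_lintegral_filter_of_dominated_convergence (μ := volume) (l := atTop)
    (F := fun n ε => ENNReal.ofReal (gaussianPDFReal 0 1 ε) *
      ENNReal.ofReal (tiltedMean (fun z => φ (t₀ + (ε + z) / s n)) ^ 2)) (f := fun _ => 0)
    (fun ε => ENNReal.ofReal (C * (c * ((τ - M) / 2) * Real.exp (-(τ - M) ^ 2 / 2))⁻¹ *
        Real.exp (-((τ - M) / 2 * |ε|))))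
    (Eventually.of_forall fun n => by have := hmD n; fun_prop) ?_ ?_ ?_
  · simpa using h
  · filter_upwards [hs.eventually_ge_atTop 1] with n hn
    refine Eventually.of_forall fun ε => ?_
    rw [← ENNReal.ofReal_mul (gaussianPDFReal_nonneg _ _ _)]
    exact ENNReal.ofReal_le_ofReal
      (gaussianPDFReal_mul_tiltedMean_sq_le hφ h0 hC hc hge ht₀ hM hn ε)
  · exact hbd.lintegral_lt_top.ne
  · refine Eventually.of_forall fun ε => ?_
    have h1 := (tendsto_tiltedMean_zero hφ h0 hC hpos hcont hs ε).pow 2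
    have h2 := ENNReal.Tendsto.const_mul (a := ENNReal.ofReal (gaussianPDFReal 0 1 ε))
      (ENNReal.tendsto_ofReal h1) (Or.inr ENNReal.ofReal_ne_top)
    simpa using h2

end Bounds

/-! ### Summability of the weights and coordinates in H(δ). -/

lemma summable_inv_mul_log_two_rpow {δ : ℝ} (hδ : 1 / 2 < δ) :
    Summable fun k : ℕ => 1 / ((k : ℝ) * Real.log 2) ^ (2 * δ) := by
  have h := (Real.summable_one_div_nat_rpow (p := 2 * δ)).2 (by linarith)
  refine (h.mul_left (1 / Real.log 2 ^ (2 * δ))).congr fun k => ?_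
  rw [Real.mul_rpow (Nat.cast_nonneg k) (Real.log_nonneg (by norm_num)), div_mul_div_comm, one_mul,
    mul_comm (Real.log 2 ^ _)]

/-- The series `∑ 1 / (m (log m)^{2δ})` converges for `δ > 1/2`. -/
lemma summable_inv_mul_log_rpow {δ : ℝ} (hδ : 1 / 2 < δ) :
    Summable fun m : ℕ => (max 2 (m : ℝ))⁻¹ / Real.log (max 2 (m : ℝ)) ^ (2 * δ) := by
  have hlog : ∀ m : ℕ, 0 < Real.log (max 2 (m : ℝ)) := fun m =>
    Real.log_pos (lt_of_lt_of_le (by norm_num) (le_max_left _ _))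
  refine (summable_condensed_iff_of_nonneg (fun m => ?_) fun m n _ hmn => ?_).1 ?_
  · have := hlog m; positivity
  · have h1 := hlog m
    have h2 : max 2 (m : ℝ) ≤ max 2 (n : ℝ) := by gcongr
    gcongr
  -- At k = 0 the maximum is 2 rather than 2^0, so the condensed series is simplified from k = 1 on.
  · rw [← summable_nat_add_iff 1]
    refine ((summable_nat_add_iff 1).2 (summable_inv_mul_log_two_rpow hδ)).congr fun k => ?_
    have h2 : max 2 (((2 ^ (k + 1) : ℕ)) : ℝ) = 2 ^ (k + 1) := by
      push_cast
      exact max_eq_right (by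
        rw [pow_succ]; nlinarith [one_le_pow₀ (M₀ := ℝ) (a := 2) (by norm_num) (n := k)])
    rw [h2, Real.log_pow, ← mul_div_assoc, mul_inv_cancel₀ (by positivity)]

namespace RegularBasis

variable {S : ℕ} (B : RegularBasis S) {δ : ℝ}

lemma two_le_a (i : B.Idx) : 2 ≤ B.a i.1.1 := by
  rcases B.type_a_or_b with h | h
  · rw [(h _ i.2.1).2]; exact le_max_left _ _
  · obtain ⟨h1, -, h3⟩ := h _ i.2.1
    rw [h3]
    have : i.1.1.toNat ≠ 0 := by omega
    exact le_self_pow₀ (by norm_num) this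

lemma weight_eq (i : B.Idx) :
    B.weight (-1 / 2) δ i = (B.a i.1.1)⁻¹ / Real.log (B.a i.1.1) ^ (2 * δ) := by
  rw [weight, show (2 * (-1 / 2) : ℝ) = -1 by norm_num, Real.rpow_neg_one]

lemma weight_pos (i : B.Idx) : 0 < B.weight (-1 / 2) δ i := by
  have h := B.two_le_a i
  have : 0 < Real.log (B.a i.1.1) := Real.log_pos (by linarith)
  rw [weight_eq]
  positivity

/-- In case (a) each level contributes one term of ∑ 1/(m (log m)^{2δ}), up to the truncation at 2.
In case (b) the 2^l weights of a level cancel the factor 2^{-l} and leave 1/(l log 2)^{2δ}. -/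
lemma summable_weight (hδ : 1 / 2 < δ) : Summable (B.weight (-1 / 2) δ) := by
  rcases B.type_a_or_b with h | h
  · have h1 : Summable fun l : ℤ =>
        (max 2 |(l : ℝ)|)⁻¹ / Real.log (max 2 |(l : ℝ)|) ^ (2 * δ) := by
      rw [summable_int_iff_summable_nat_and_neg]
      constructor <;> simpa using summable_inv_mul_log_rpow hδ
    have hinj : Function.Injective fun i : B.Idx => i.1.1 := by
      intro i j hij
      have hij' : i.1.1 = j.1.1 := hij
      have hcard := (h _ i.2.1).1
      have hk : i.1.2 = j.1.2 := Finset.card_le_one.1 hcard.le _ i.2.2 _ (by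
        rw [hij']; exact j.2.2)
      exact Subtype.ext (Prod.ext hij' hk)
    refine (h1.comp_injective hinj).congr fun i => ?_
    rw [weight_eq, (h _ i.2.1).2]
    rfl
  · let e : B.Idx → Σ l : B.L, B.Z l := fun i => ⟨⟨i.1.1, i.2.1⟩, ⟨i.1.2, i.2.2⟩⟩
    have he : Function.Injective e := by
      rintro ⟨⟨l, k⟩, hi⟩ ⟨⟨l', k'⟩, hj⟩ hij
      simp only [e, Sigma.mk.injEq, Subtype.mk.injEq] at hij
      obtain ⟨rfl, h2⟩ := hij
      simp only [heq_eq_eq, Subtype.mk.injEq] at h2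
      subst h2
      rfl
    have h1 : Summable fun q : Σ l : B.L, B.Z l =>
        (B.a q.1)⁻¹ / Real.log (B.a q.1) ^ (2 * δ) := by
      refine (summable_sigma_of_nonneg fun q => ?_).2 ⟨fun l => (hasSum_fintype _).summable, ?_⟩
      · have := B.two_le_a ⟨(q.1.1, q.2.1), q.1.2, q.2.2⟩
        have : 0 ≤ Real.log (B.a q.1) := Real.log_nonneg (by simp at this; linarith)
        have : 0 ≤ B.a q.1 := by rw [(h _ q.1.2).2.2]; positivity
        positivity
      · have hinj : Function.Injective fun l : B.L => l.1.toNat := by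
          intro l l' hll
          have h1 := (h _ l.2).1
          have h2 := (h _ l'.2).1
          have hll' : l.1.toNat = l'.1.toNat := hll
          exact Subtype.ext (by omega)
        refine ((summable_inv_mul_log_two_rpow hδ).comp_injective hinj).congr fun l => ?_
        simp only [tsum_fintype, Finset.sum_const, Finset.card_univ, Fintype.card_coe,
          nsmul_eq_mul, Function.comp_apply]
        rw [(h _ l.2).2.1, (h _ l.2).2.2, Real.log_pow, ← mul_div_assoc]
        push_cast
        rw [mul_inv_cancel₀ (by positivity)]
    refine (h1.comp_injective he).congr fun i => ?_
    rw [weight_eq]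
    rfl

lemma lintegral_weightMeasure (f : B.Idx → ℝ≥0∞) :
    ∫⁻ i, f i ∂B.weightMeasure (-1 / 2) δ =
      ∑' i, ENNReal.ofReal (B.weight (-1 / 2) δ i) * f i := by
  rw [weightMeasure, lintegral_withDensity_eq_lintegral_mul _ (measurable_of_countable _)
    (measurable_of_countable _), lintegral_count]
  rfl

/-- Every index has positive mass, so elements of H(δ) have genuine coordinates although they are
classes of functions. -/
lemma ae_weightMeasure_iff {P : B.Idx → Prop} :
    (∀ᵐ i ∂B.weightMeasure (-1 / 2) δ, P i) ↔ ∀ i, P i := by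
  rw [weightMeasure, ae_withDensity_iff (measurable_of_countable _)]
  simp [B.weight_pos, Measure.ae_count_iff]

lemma eLpNorm_sq (x : B.Idx → ℝ) :
    eLpNorm x 2 (B.weightMeasure (-1 / 2) δ) ^ 2 =
      ∑' i, ENNReal.ofReal (B.weight (-1 / 2) δ i) * ENNReal.ofReal (x i ^ 2) := by
  rw [eLpNorm_eq_lintegral_rpow_enorm_toReal two_ne_zero ENNReal.ofNat_ne_top,
    ← ENNReal.rpow_natCast, ← ENNReal.rpow_mul, lintegral_weightMeasure]
  norm_num
  refine tsum_congr fun i => ?_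
  rw [Real.enorm_eq_ofReal_abs, ← ENNReal.ofReal_pow (abs_nonneg _), sq_abs]

lemma memLp_iff (x : B.Idx → ℝ) :
    MemLp x 2 (B.weightMeasure (-1 / 2) δ) ↔
      ∑' i, ENNReal.ofReal (B.weight (-1 / 2) δ i) * ENNReal.ofReal (x i ^ 2) ≠ ∞ := by
  rw [← eLpNorm_sq]
  simp only [ne_eq, ENNReal.pow_eq_top_iff, MemLp,
    (measurable_of_countable x).aestronglyMeasurable, true_and]
  simp [lt_top_iff_ne_top]

lemma ofCoeff_apply {x : B.Idx → ℝ} (h : MemLp x 2 (B.weightMeasure (-1 / 2) δ)) (i : B.Idx) :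
    B.ofCoeff δ x i = x i := by
  rw [ofCoeff, dif_pos h]
  exact B.ae_weightMeasure_iff.1 h.coeFn_toLp i

lemma add_coord (x y : B.H δ) (i : B.Idx) : (x + y) i = x i + y i :=
  B.ae_weightMeasure_iff.1 (Lp.coeFn_add x y) i

lemma sub_coord (x y : B.H δ) (i : B.Idx) : (x - y) i = x i - y i :=
  B.ae_weightMeasure_iff.1 (Lp.coeFn_sub x y) i

lemma smul_coord (c : ℝ) (x : B.H δ) (i : B.Idx) : (c • x) i = c * x i :=
  B.ae_weightMeasure_iff.1 (Lp.coeFn_smul c x) i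

lemma H_ext {x y : B.H δ} (h : ∀ i, x i = y i) : x = y :=
  Lp.ext (Eventually.of_forall h)

lemma enorm_sq (x : B.H δ) :
    ‖x‖ₑ ^ 2 = ∑' i, ENNReal.ofReal (B.weight (-1 / 2) δ i) * ENNReal.ofReal (x i ^ 2) := by
  rw [← eLpNorm_sq, Lp.enorm_def]

lemma weight_mul_coord_sq_le (x : B.H δ) (i : B.Idx) :
    B.weight (-1 / 2) δ i * x i ^ 2 ≤ ‖x‖ ^ 2 := by
  rw [← ENNReal.ofReal_le_ofReal_iff (sq_nonneg _), ENNReal.ofReal_mul (B.weight_pos i).le,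
    ENNReal.ofReal_pow (norm_nonneg x), ofReal_norm, enorm_sq]
  exact ENNReal.le_tsum i

lemma measurable_coord (i : B.Idx) : Measurable fun x : B.H δ => x i := by
  have hw := B.weight_pos (δ := δ) i
  refine (LipschitzWith.of_dist_le_mul (K := ⟨(√(B.weight (-1 / 2) δ i))⁻¹, by positivity⟩)
    fun x y => ?_).continuous.measurable
  change |x i - y i| ≤ (√(B.weight (-1 / 2) δ i))⁻¹ * dist x y
  rw [le_inv_mul_iff₀ (Real.sqrt_pos.2 hw), dist_eq_norm, ← sub_coord]
  refine abs_le_of_sq_le_sq' ?_ (norm_nonneg _) |>.2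
  rw [mul_pow, Real.sq_sqrt hw.le, sq_abs]
  exact B.weight_mul_coord_sq_le (x - y) i

lemma hasSum_coeff_sq (f : L2) : HasSum (fun i => B.coeff f i ^ 2) (‖f‖ ^ 2) := by
  have h := B.basis.hasSum_inner_mul_inner f f
  rw [real_inner_self_eq_norm_sq] at h
  refine h.congr_fun fun i => ?_
  rw [coeff, sq, real_inner_comm]

lemma memLp_of_summable_sq (hδ : 1 / 2 < δ) {x : B.Idx → ℝ} (hx : Summable fun i => x i ^ 2) :
    MemLp x 2 (B.weightMeasure (-1 / 2) δ) := by
  rw [memLp_iff]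
  have hle : ∀ i, B.weight (-1 / 2) δ i ≤ ∑' j, B.weight (-1 / 2) δ j := fun i =>
    (B.summable_weight hδ).le_tsum i fun j _ => (B.weight_pos j).le
  refine ne_top_of_le_ne_top ?_ (ENNReal.tsum_le_tsum fun i =>
    mul_le_mul_left (ENNReal.ofReal_le_ofReal (hle i)) _)
  rw [ENNReal.tsum_mul_left, ← ENNReal.ofReal_tsum_of_nonneg (fun i => sq_nonneg _) hx]
  exact ENNReal.mul_ne_top ENNReal.ofReal_ne_top ENNReal.ofReal_ne_top

/-- The expected squared H(δ)-norm of the noise is the sum of the weights, which is finite. -/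
lemma ae_memLp_gaussianArray (hδ : 1 / 2 < δ) :
    ∀ᵐ ε ∂B.gaussianArray, MemLp ε 2 (B.weightMeasure (-1 / 2) δ) := by
  have hm : ∀ i : B.Idx, Measurable fun ε : B.Idx → ℝ => ENNReal.ofReal (ε i ^ 2) :=
    fun i => by fun_prop
  have h1 : ∫⁻ ε, ∑' i, ENNReal.ofReal (B.weight (-1 / 2) δ i) * ENNReal.ofReal (ε i ^ 2)
      ∂B.gaussianArray ≠ ∞ := by
    rw [lintegral_tsum fun i => ((hm i).const_mul _).aemeasurable]
    have h2 : ∀ i : B.Idx, ∫⁻ ε, ENNReal.ofReal (ε i ^ 2) ∂B.gaussianArray = 1 := by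
      intro i
      rw [gaussianArray, (measurePreserving_eval_infinitePi (fun _ : B.Idx => gaussianReal 0 1)
        i).lintegral_comp (f := fun t : ℝ => ENNReal.ofReal (t ^ 2)) (by fun_prop),
        ← ofReal_integral_eq_lintegral_ofReal integrable_sq_gaussianReal
          (Eventually.of_forall fun z => sq_nonneg z), integral_sq_gaussianReal,
        ENNReal.ofReal_one]
    have h3 : ∀ i : B.Idx, ∫⁻ ε, ENNReal.ofReal (B.weight (-1 / 2) δ i) *
        ENNReal.ofReal (ε i ^ 2) ∂B.gaussianArray = ENNReal.ofReal (B.weight (-1 / 2) δ i) :=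
      fun i => by rw [lintegral_const_mul _ (hm i), h2, mul_one]
    rw [tsum_congr h3]
    exact (B.summable_weight hδ).tsum_ofReal_ne_top
  filter_upwards [ae_lt_top (Measurable.tsum fun i => (hm i).const_mul _) h1] with ε hε
  exact (B.memLp_iff ε).2 hε.ne

lemma memLp_coeff (hδ : 1 / 2 < δ) (f : L2) :
    MemLp (B.coeff f) 2 (B.weightMeasure (-1 / 2) δ) :=
  B.memLp_of_summable_sq hδ (B.hasSum_coeff_sq f).summable

lemma embed_apply (hδ : 1 / 2 < δ) (f : L2) (i : B.Idx) : B.embed δ f i = B.coeff f i :=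
  B.ofCoeff_apply (B.memLp_coeff hδ f) i

lemma coeff_add (f g : L2) (i : B.Idx) : B.coeff (f + g) i = B.coeff f i + B.coeff g i :=
  inner_add_right _ _ _

lemma coeff_smul (c : ℝ) (f : L2) (i : B.Idx) : B.coeff (c • f) i = c * B.coeff f i :=
  inner_smul_right _ _ _

lemma norm_embed_le (hδ : 1 / 2 < δ) (f : L2) :
    ‖B.embed δ f‖ ≤ √(∑' i, B.weight (-1 / 2) δ i) * ‖f‖ := by
  have hW : 0 ≤ ∑' i, B.weight (-1 / 2) δ i := tsum_nonneg fun i => (B.weight_pos i).le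
  refine (abs_le_of_sq_le_sq' ?_ (by positivity)).2
  rw [mul_pow, Real.sq_sqrt hW, ← ENNReal.ofReal_le_ofReal_iff (by positivity),
    ENNReal.ofReal_pow (norm_nonneg _), ofReal_norm, enorm_sq, ENNReal.ofReal_mul hW,
    ← (B.hasSum_coeff_sq f).tsum_eq, ENNReal.ofReal_tsum_of_nonneg (fun i => sq_nonneg _)
      (B.hasSum_coeff_sq f).summable, ← ENNReal.tsum_mul_left]
  refine ENNReal.tsum_le_tsum fun i => ?_
  rw [B.embed_apply hδ]
  gcongr
  exact (B.summable_weight hδ).le_tsum i fun j _ => (B.weight_pos j).le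

/-- The injection `L² ⊆ H(δ)` as a continuous linear map. -/
def embedL (hδ : 1 / 2 < δ) : L2 →L[ℝ] B.H δ :=
  LinearMap.mkContinuous
    { toFun := B.embed δ
      map_add' := fun f g => B.H_ext fun i => by
        rw [add_coord, B.embed_apply hδ, B.embed_apply hδ, B.embed_apply hδ, coeff_add]
      map_smul' := fun c f => B.H_ext fun i => by
        rw [RingHom.id_apply, smul_coord, B.embed_apply hδ, B.embed_apply hδ, coeff_smul] }
    (√(∑' i, B.weight (-1 / 2) δ i)) (B.norm_embed_le hδ)

/-- The function with coefficients `θ`. -/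
def series (θ : B.Idx → ℝ) : L2 := ∑' i, θ i • (B.basis i : L2)

lemma measurable_series : Measurable B.series :=
  Measurable.tsum fun i => (measurable_pi_apply i).smul_const _

lemma coeff_series {θ : B.Idx → ℝ} (h : Summable fun i => θ i ^ 2) (i : B.Idx) :
    B.coeff (B.series θ) i = θ i := by
  have hm : Memℓp θ 2 := by
    refine memℓp_gen ?_
    simpa using h
  have h1 := B.basis.hasSum_repr_symm ⟨θ, hm⟩
  have h2 : B.series θ = B.basis.repr.symm ⟨θ, hm⟩ := h1.tsum_eq
  rw [h2, coeff, ← HilbertBasis.repr_apply_apply, LinearIsometryEquiv.apply_symm_apply]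

lemma embed_series_add (hδ : 1 / 2 < δ) {θ ε : B.Idx → ℝ} (h : Summable fun i => θ i ^ 2)
    (hε : MemLp ε 2 (B.weightMeasure (-1 / 2) δ)) (r : ℝ) :
    B.embed δ (B.series θ) + r • B.ofCoeff δ ε = B.ofCoeff δ (θ + r • ε) := by
  refine B.H_ext fun i => ?_
  rw [add_coord, smul_coord, B.embed_apply hδ, coeff_series _ h, B.ofCoeff_apply hε,
    B.ofCoeff_apply ((B.memLp_of_summable_sq hδ h).add (hε.const_smul r))]
  rfl

/-! ### The observation as a function of the noise array; contiguity. -/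

lemma obsLaw_eq_map (n : ℕ) (f : L2) :
    B.obsLaw δ n f =
      B.gaussianArray.map fun ε => B.embed δ f + (√(n : ℝ))⁻¹ • B.ofCoeff δ ε := by
  rw [obsLaw, stdGaussian, Measure.map_map (by fun_prop) (B.measurable_ofCoeff δ)]
  rfl

lemma measurable_obs (n : ℕ) (f : L2) :
    Measurable fun ε : B.Idx → ℝ => B.embed δ f + (√(n : ℝ))⁻¹ • B.ofCoeff δ ε :=
  Measurable.comp (g := fun w : B.H δ => B.embed δ f + (√(n : ℝ))⁻¹ • w) (by fun_prop)
    (B.measurable_ofCoeff δ)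

/-- Quantitative contiguity of the laws of the observation under local perturbations. -/
lemma obsLaw_add_sq_le (hδ : 1 / 2 < δ) {n : ℕ} (hn : 1 ≤ n) (f g : L2) {A : Set (B.H δ)}
    (hA : MeasurableSet A) :
    (B.obsLaw δ n (f + g) A) ^ 2 ≤
      ENNReal.ofReal (Real.exp (n * ‖g‖ ^ 2)) * B.obsLaw δ n f A := by
  classical
  have hn0 : (0 : ℝ) < n := by exact_mod_cast hn
  have hsq : (0 : ℝ) < √(n : ℝ) := Real.sqrt_pos.2 hn0
  -- Adding g to the signal amounts to shifting the noise array by √n times the coefficients of g.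
  set h : B.Idx → ℝ := √(n : ℝ) • B.coeff g
  have hsum : HasSum (fun i => h i ^ 2) (n * ‖g‖ ^ 2) := by
    refine ((B.hasSum_coeff_sq g).mul_left (n : ℝ)).congr_fun fun i => ?_
    simp [h, mul_pow, Real.sq_sqrt hn0.le]
  have hcm := infinitePi_gaussian_shift_sq_le h hsum.summable
    ((fun ε => B.embed δ f + (√(n : ℝ))⁻¹ • B.ofCoeff δ ε) ⁻¹' A)
  rw [hsum.tsum_eq] at hcm
  rw [obsLaw_eq_map, obsLaw_eq_map, Measure.map_apply (B.measurable_obs n _) hA,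
    Measure.map_apply (B.measurable_obs n _) hA]
  refine le_trans (le_of_eq ?_) hcm
  congr 1
  refine measure_congr ?_
  filter_upwards [B.ae_memLp_gaussianArray hδ] with ε hε
  refine propext (iff_of_eq ?_)
  change (B.embed δ (f + g) + (√(n : ℝ))⁻¹ • B.ofCoeff δ ε ∈ A) =
    (B.embed δ f + (√(n : ℝ))⁻¹ • B.ofCoeff δ (ε + h) ∈ A)
  congr 1
  refine B.H_ext fun i => ?_
  rw [add_coord, add_coord, smul_coord, smul_coord, B.embed_apply hδ, B.embed_apply hδ,
    B.ofCoeff_apply hε, B.ofCoeff_apply (hε.add ((B.memLp_coeff hδ g).const_smul _)), coeff_add]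
  simp only [Pi.add_apply, Pi.smul_apply, smul_eq_mul]
  field_simp
  ring

lemma obsLaw_absolutelyContinuous (hδ : 1 / 2 < δ) {n : ℕ} (hn : 1 ≤ n) (f g : L2) :
    B.obsLaw δ n f ≪ B.obsLaw δ n g := by
  refine Measure.AbsolutelyContinuous.mk fun A hA h0 => ?_
  have := B.obsLaw_add_sq_le hδ hn g (f - g) hA
  rw [h0, mul_zero, add_sub_cancel] at this
  simpa using this

end RegularBasis

/-! ### The product prior and the joint law of parameter and observation. -/

namespace RegularBasis

variable {S : ℕ} (B : RegularBasis S) {δ : ℝ}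

/-- The prior density of the coefficient with index `i`. -/
def coordDensity (φ : ℝ → ℝ) (σ : ℤ → ℝ) (i : B.Idx) (x : ℝ) : ℝ :=
  (σ i.1.1)⁻¹ * φ (x / σ i.1.1)

lemma productPrior_eq (φ : ℝ → ℝ) (σ : ℤ → ℝ) :
    B.productPrior φ σ = (Measure.infinitePi (B.coordLaw φ σ)).map B.series := rfl

section Prior

variable {φ : ℝ → ℝ} {σ : ℤ → ℝ}

lemma measurable_coordDensity (hφ : Measurable φ) (i : B.Idx) :
    Measurable (B.coordDensity φ σ i) :=
  (hφ.comp (measurable_id.div_const _)).const_mul _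

lemma coordDensity_nonneg (h0 : ∀ x, 0 ≤ φ x) (hσ : ∀ l ∈ B.L, 0 < σ l) (i : B.Idx) (x : ℝ) :
    0 ≤ B.coordDensity φ σ i x :=
  mul_nonneg (inv_nonneg.2 (hσ _ i.2.1).le) (h0 _)

lemma coordDensity_le {C : ℝ} (hC : ∀ x, φ x ≤ C) (hσ : ∀ l ∈ B.L, 0 < σ l) (i : B.Idx) (x : ℝ) :
    B.coordDensity φ σ i x ≤ (σ i.1.1)⁻¹ * C :=
  mul_le_mul_of_nonneg_left (hC _) (inv_nonneg.2 (hσ _ i.2.1).le)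

lemma isProbabilityMeasure_coordLaw (hφ : Measurable φ)
    (hmass : ∫⁻ x, ENNReal.ofReal (φ x) = 1) (hσ : ∀ l ∈ B.L, 0 < σ l) (i : B.Idx) :
    IsProbabilityMeasure (B.coordLaw φ σ i) := by
  have hs := hσ _ i.2.1
  refine ⟨?_⟩
  rw [coordLaw, withDensity_apply _ MeasurableSet.univ, Measure.restrict_univ]
  have h := lintegral_comp_add_div hφ 0 0 hs
  simp only [zero_add, add_zero] at h
  simp_rw [ENNReal.ofReal_mul (inv_nonneg.2 hs.le)]
  rw [lintegral_const_mul' _ _ ENNReal.ofReal_ne_top, h, hmass, mul_one,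
    ← ENNReal.ofReal_mul (inv_nonneg.2 hs.le), inv_mul_cancel₀ hs.ne', ENNReal.ofReal_one]

lemma lintegral_sq_coordLaw (hφ : Measurable φ) (hσ : ∀ l ∈ B.L, 0 < σ l) (i : B.Idx) :
    ∫⁻ x, ENNReal.ofReal (x ^ 2) ∂B.coordLaw φ σ i =
      ENNReal.ofReal (σ i.1.1 ^ 2) * ∫⁻ x, ENNReal.ofReal (x ^ 2 * φ x) := by
  have hs := hσ _ i.2.1
  have h := lintegral_comp_add_div (φ := fun x => x ^ 2 * φ x) (by fun_prop) 0 0 hs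
  simp only [zero_add, add_zero] at h
  have h2 : ENNReal.ofReal (σ i.1.1 ^ 2) = ENNReal.ofReal (σ i.1.1) * ENNReal.ofReal (σ i.1.1) := by
    rw [← ENNReal.ofReal_mul hs.le, sq]
  rw [h2, mul_assoc, ← h, ← lintegral_const_mul' _ _ ENNReal.ofReal_ne_top, coordLaw,
    lintegral_withDensity_eq_lintegral_mul _ (by fun_prop) (by fun_prop)]
  refine lintegral_congr fun x => ?_
  rw [Pi.mul_apply, ← ENNReal.ofReal_mul hs.le, ← ENNReal.ofReal_mul' (sq_nonneg x)]
  congr 1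
  field_simp

lemma integrable_id_coordLaw (hφ : Measurable φ)
    (hmass : ∫⁻ x, ENNReal.ofReal (φ x) = 1) (hsq : Integrable fun x => x ^ 2 * φ x)
    (hσ : ∀ l ∈ B.L, 0 < σ l) (i : B.Idx) :
    Integrable (fun x => x) (B.coordLaw φ σ i) := by
  have := B.isProbabilityMeasure_coordLaw hφ hmass hσ i
  have h : MemLp (fun x : ℝ => x) 2 (B.coordLaw φ σ i) := by
    refine (memLp_two_iff_integrable_sq (by fun_prop)).2 ⟨by fun_prop, ?_⟩
    rw [hasFiniteIntegral_iff_ofReal (Eventually.of_forall fun x => sq_nonneg x),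
      B.lintegral_sq_coordLaw hφ hσ]
    exact ENNReal.mul_lt_top ENNReal.ofReal_lt_top hsq.lintegral_lt_top
  exact h.integrable one_le_two

lemma lintegral_tsum_sq_lt_top (hφ : Measurable φ)
    (hmass : ∫⁻ x, ENNReal.ofReal (φ x) = 1) (hsq : Integrable fun x => x ^ 2 * φ x)
    (hσ : ∀ l ∈ B.L, 0 < σ l) (hσs : Summable fun i : B.Idx => σ i.1.1 ^ 2) :
    ∫⁻ θ, ∑' i, ENNReal.ofReal (θ i ^ 2) ∂Measure.infinitePi (B.coordLaw φ σ) < ∞ := by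
  have := B.isProbabilityMeasure_coordLaw hφ hmass hσ
  rw [lintegral_tsum fun i => Measurable.aemeasurable (by fun_prop)]
  have h : ∀ i : B.Idx, ∫⁻ θ, ENNReal.ofReal (θ i ^ 2) ∂Measure.infinitePi (B.coordLaw φ σ) =
      ENNReal.ofReal (σ i.1.1 ^ 2) * ∫⁻ x, ENNReal.ofReal (x ^ 2 * φ x) := by
    intro i
    rw [(measurePreserving_eval_infinitePi (B.coordLaw φ σ) i).lintegral_comp
      (f := fun t : ℝ => ENNReal.ofReal (t ^ 2)) (by fun_prop), B.lintegral_sq_coordLaw hφ hσ]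
  rw [tsum_congr h, ENNReal.tsum_mul_right]
  exact ENNReal.mul_lt_top hσs.tsum_ofReal_lt_top hsq.lintegral_lt_top

lemma ae_summable_sq (hφ : Measurable φ)
    (hmass : ∫⁻ x, ENNReal.ofReal (φ x) = 1) (hsq : Integrable fun x => x ^ 2 * φ x)
    (hσ : ∀ l ∈ B.L, 0 < σ l) (hσs : Summable fun i : B.Idx => σ i.1.1 ^ 2) :
    ∀ᵐ θ ∂Measure.infinitePi (B.coordLaw φ σ), Summable fun i => θ i ^ 2 := by
  filter_upwards [ae_lt_top (Measurable.tsum fun i => by fun_prop)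
    (B.lintegral_tsum_sq_lt_top hφ hmass hsq hσ hσs).ne] with θ hθ
  have := ENNReal.summable_toReal hθ.ne
  exact this.congr fun i => ENNReal.toReal_ofReal (sq_nonneg _)

lemma integrable_series (hφ : Measurable φ)
    (hmass : ∫⁻ x, ENNReal.ofReal (φ x) = 1) (hsq : Integrable fun x => x ^ 2 * φ x)
    (hσ : ∀ l ∈ B.L, 0 < σ l) (hσs : Summable fun i : B.Idx => σ i.1.1 ^ 2) :
    Integrable B.series (Measure.infinitePi (B.coordLaw φ σ)) := by
  have := B.isProbabilityMeasure_coordLaw hφ hmass hσ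
  have hm := B.measurable_series.aestronglyMeasurable (μ := Measure.infinitePi (B.coordLaw φ σ))
  have h : MemLp B.series 2 (Measure.infinitePi (B.coordLaw φ σ)) := by
    refine (memLp_two_iff_integrable_sq_norm hm).2 ⟨hm.norm.pow 2, ?_⟩
    rw [hasFiniteIntegral_iff_ofReal (Eventually.of_forall fun x => sq_nonneg _)]
    refine lt_of_le_of_lt (le_of_eq ?_) (B.lintegral_tsum_sq_lt_top hφ hmass hsq hσ hσs)
    refine lintegral_congr_ae ?_
    filter_upwards [B.ae_summable_sq hφ hmass hsq hσ hσs] with θ hθ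
    rw [← (B.hasSum_coeff_sq _).tsum_eq, ENNReal.ofReal_tsum_of_nonneg (fun i => sq_nonneg _)
      (B.hasSum_coeff_sq _).summable]
    simp_rw [B.coeff_series hθ]
  exact h.integrable one_le_two

/-- The joint law of parameter and observation, in terms of the arrays of prior coefficients and
noise variables. -/
lemma compProd_experiment (hδ : 1 / 2 < δ) (hφ : Measurable φ)
    (hmass : ∫⁻ x, ENNReal.ofReal (φ x) = 1) (hsq : Integrable fun x => x ^ 2 * φ x)
    (hσ : ∀ l ∈ B.L, 0 < σ l) (hσs : Summable fun i : B.Idx => σ i.1.1 ^ 2) (n : ℕ) :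
    B.productPrior φ σ ⊗ₘ B.experiment δ n =
      ((Measure.infinitePi (B.coordLaw φ σ)).prod B.gaussianArray).map
        fun q => (B.series q.1, B.ofCoeff δ (q.1 + (√(n : ℝ))⁻¹ • q.2)) := by
  have := B.isProbabilityMeasure_coordLaw hφ hmass hσ
  have hX : Measurable fun q : (B.Idx → ℝ) × (B.Idx → ℝ) =>
      B.ofCoeff δ (q.1 + (√(n : ℝ))⁻¹ • q.2) := (B.measurable_ofCoeff δ).comp (by fun_prop)
  have hFX := (B.measurable_series.comp measurable_fst).prodMk hX
  ext s hs
  rw [Measure.compProd_apply hs, productPrior_eq, lintegral_map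
    (Kernel.measurable_kernel_prodMk_left hs) B.measurable_series]
  refine Eq.trans ?_ (Measure.map_apply hFX hs).symm
  rw [Measure.prod_apply (hFX hs)]
  refine lintegral_congr_ae ?_
  filter_upwards [B.ae_summable_sq hφ hmass hsq hσ hσs] with θ hθ
  change B.obsLaw δ n (B.series θ) _ = _
  rw [obsLaw_eq_map, Measure.map_apply (B.measurable_obs n _) (measurable_prodMk_left hs)]
  refine measure_congr ?_
  filter_upwards [B.ae_memLp_gaussianArray hδ] with ε hε
  refine propext (iff_of_eq ?_)
  change ((B.series θ, B.embed δ (B.series θ) + (√(n : ℝ))⁻¹ • B.ofCoeff δ ε) ∈ s) =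
    ((B.series θ, B.ofCoeff δ (θ + (√(n : ℝ))⁻¹ • ε)) ∈ s)
  rw [B.embed_series_add hδ hθ hε]

lemma isProbabilityMeasure_productPrior (hφ : Measurable φ)
    (hmass : ∫⁻ x, ENNReal.ofReal (φ x) = 1) (hσ : ∀ l ∈ B.L, 0 < σ l) :
    IsProbabilityMeasure (B.productPrior φ σ) := by
  have := B.isProbabilityMeasure_coordLaw hφ hmass hσ
  exact Measure.isProbabilityMeasure_map B.measurable_series.aemeasurable

/-- A null set of the marginal law is null under P_g^n for at least one g, hence under every P_f^n.
This moves statements about the posterior, known only marginal-almost everywhere, to the true law.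
-/
lemma obsLaw_absolutelyContinuous_comp (hδ : 1 / 2 < δ) {n : ℕ} (hn : 1 ≤ n)
    (prior : Measure L2) [IsProbabilityMeasure prior] (f : L2) :
    B.obsLaw δ n f ≪ B.experiment δ n ∘ₘ prior := by
  refine Measure.AbsolutelyContinuous.mk fun A hA h0 => ?_
  rw [Measure.bind_apply hA (Kernel.aemeasurable _),
    lintegral_eq_zero_iff (Kernel.measurable_coe _ hA)] at h0
  obtain ⟨g, hg⟩ := h0.exists
  exact B.obsLaw_absolutelyContinuous hδ hn f g hg

end Prior

end RegularBasis

/-! ### The coefficients of the posterior mean. -/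

section Resampling

variable {ι : Type*} (π : ι → Measure ℝ) [∀ i, IsProbabilityMeasure (π i)]
  (ν : ι → Measure ℝ) [∀ i, IsProbabilityMeasure (ν i)]

/-- Resampling a coordinate of two independent product arrays. -/
lemma measurePreserving_update_pair [DecidableEq ι] (i : ι) :
    MeasurePreserving (fun q : (ℝ × ℝ) × ((ι → ℝ) × (ι → ℝ)) =>
        (Function.update q.2.1 i q.1.2, Function.update q.2.2 i q.1.1))
      (((ν i).prod (π i)).prod ((Measure.infinitePi π).prod (Measure.infinitePi ν)))
      ((Measure.infinitePi π).prod (Measure.infinitePi ν)) := by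
  have h1 := measurePreserving_prodAssoc (ν i) (π i)
    ((Measure.infinitePi π).prod (Measure.infinitePi ν))
  have h2 := (MeasurePreserving.id (ν i)).prod
    (measurePreserving_prodAssoc (π i) (Measure.infinitePi π) (Measure.infinitePi ν)).symm
  have h3 := (measurePreserving_prodAssoc (ν i) ((π i).prod (Measure.infinitePi π))
    (Measure.infinitePi ν)).symm
  have h4 := (Measure.measurePreserving_swap (μ := ν i)
    (ν := (π i).prod (Measure.infinitePi π))).prod (MeasurePreserving.id (Measure.infinitePi ν))
  have h5 := measurePreserving_prodAssoc ((π i).prod (Measure.infinitePi π)) (ν i)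
    (Measure.infinitePi ν)
  have u1 : MeasurePreserving (fun p : ℝ × (ι → ℝ) => Function.update p.2 i p.1)
      ((π i).prod (Measure.infinitePi π)) (Measure.infinitePi π) :=
    ⟨measurable_update_pair (X := fun _ => ℝ) i, infinitePi_map_update π i⟩
  have u2 : MeasurePreserving (fun p : ℝ × (ι → ℝ) => Function.update p.2 i p.1)
      ((ν i).prod (Measure.infinitePi ν)) (Measure.infinitePi ν) :=
    ⟨measurable_update_pair (X := fun _ => ℝ) i, infinitePi_map_update ν i⟩
  exact (u1.prod u2).comp (h5.comp (h4.comp (h3.comp (h2.comp h1))))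

lemma measurePreserving_eval_pair (i : ι) :
    MeasurePreserving (fun q : (ι → ℝ) × (ι → ℝ) => (q.2 i, q.1 i))
      ((Measure.infinitePi π).prod (Measure.infinitePi ν)) ((ν i).prod (π i)) :=
  Measure.measurePreserving_swap.comp ((measurePreserving_eval_infinitePi π i).prod
    (measurePreserving_eval_infinitePi ν i))

end Resampling

/-- Coordinate `i` of both arrays is resampled independently of the rest. With the other coordinates
frozen, `A` becomes a set of reals and the scalar Bayes formula applies, which is why conditioning
on the whole array reduces to conditioning on x_i. -/
lemma setIntegral_coord_eq_condMean {ι : Type*} (p : ι → ℝ → ℝ)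
    (hπ : ∀ i, IsProbabilityMeasure (volume.withDensity fun x => ENNReal.ofReal (p i x)))
    (i : ι) {C : ℝ} (hp : Measurable (p i)) (h0 : ∀ x, 0 ≤ p i x) (hC : ∀ x, p i x ≤ C)
    (hmass : Integrable (fun x => x) (volume.withDensity fun x => ENNReal.ofReal (p i x)))
    (r : ℝ) {A : Set (ι → ℝ)} (hA : MeasurableSet A) :
    ∫ q, A.indicator (fun _ => q.1 i) (q.1 + r • q.2)
      ∂(Measure.infinitePi fun i => volume.withDensity fun x => ENNReal.ofReal (p i x)).prod
        (Measure.infinitePi fun _ : ι => gaussianReal 0 1) =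
    ∫ q, A.indicator (fun x => condMean (p i) r (x i)) (q.1 + r • q.2)
      ∂(Measure.infinitePi fun i => volume.withDensity fun x => ENNReal.ofReal (p i x)).prod
        (Measure.infinitePi fun _ : ι => gaussianReal 0 1) := by
  classical
  set π : ι → Measure ℝ := fun i => volume.withDensity fun x => ENNReal.ofReal (p i x) with hπdef
  set ν : ι → Measure ℝ := fun _ => gaussianReal 0 1
  have hΦ := measurePreserving_update_pair π ν i
  have hev := measurePreserving_eval_pair π ν i
  have hcm := measurable_condMean hp r
  have hX : Measurable fun q : (ι → ℝ) × (ι → ℝ) => q.1 + r • q.2 := by fun_prop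
  have i1 : Integrable (fun q : (ι → ℝ) × (ι → ℝ) => A.indicator (fun _ => q.1 i) (q.1 + r • q.2))
      ((Measure.infinitePi π).prod (Measure.infinitePi ν)) := by
    have : Integrable (fun q : (ι → ℝ) × (ι → ℝ) => q.1 i)
        ((Measure.infinitePi π).prod (Measure.infinitePi ν)) :=
      hev.integrable_comp_of_integrable (g := fun q : ℝ × ℝ => q.2) (hmass.comp_snd _)
    exact (this.indicator (hX hA)).congr (Eventually.of_forall fun q => rfl)
  have i2 : Integrable (fun q : (ι → ℝ) × (ι → ℝ) =>
      A.indicator (fun x => condMean (p i) r (x i)) (q.1 + r • q.2))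
      ((Measure.infinitePi π).prod (Measure.infinitePi ν)) := by
    have : Integrable (fun q : (ι → ℝ) × (ι → ℝ) => condMean (p i) r (q.1 i + r * q.2 i))
        ((Measure.infinitePi π).prod (Measure.infinitePi ν)) :=
      hev.integrable_comp_of_integrable (g := fun q : ℝ × ℝ => condMean (p i) r (q.2 + r * q.1))
        (integrable_condMean hp h0 hC hmass r)
    exact (this.indicator (hX hA)).congr (Eventually.of_forall fun q => rfl)
  have hupd : ∀ (q : (ι → ℝ) × (ι → ℝ)) (e t : ℝ),
      Function.update q.1 i t + r • Function.update q.2 i e =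
        Function.update (q.1 + r • q.2) i (t + r * e) := by
    intro q e t
    ext j
    by_cases h : j = i
    · subst h; simp
    · simp [h]
  have j1 := hΦ.integrable_comp_of_integrable i1
  have j2 := hΦ.integrable_comp_of_integrable i2
  conv_lhs => rw [← hΦ.map_eq]
  conv_rhs => rw [← hΦ.map_eq]
  rw [integral_map hΦ.measurable.aemeasurable (hΦ.map_eq.symm ▸ i1.aestronglyMeasurable),
    integral_map hΦ.measurable.aemeasurable (hΦ.map_eq.symm ▸ i2.aestronglyMeasurable)]
  refine (integral_prod_symm _ j1).trans (Eq.trans ?_ (integral_prod_symm _ j2).symm)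
  congr 1
  ext q
  have hA' : MeasurableSet {x | Function.update (q.1 + r • q.2) i x ∈ A} :=
    measurable_update _ hA
  have h := integral_mul_indicator_eq_condMean hp h0 hC hmass r hA'
  refine Eq.trans ?_ (h.trans ?_)
  · refine integral_congr_ae (Eventually.of_forall fun a => ?_)
    simp only [Function.comp_apply, hupd, Set.indicator_apply, Function.update_self]
    rfl
  · refine integral_congr_ae (Eventually.of_forall fun a => ?_)
    simp only [Function.comp_apply, hupd, Set.indicator_apply, Function.update_self]
    rfl

namespace RegularBasis

variable {S : ℕ} (B : RegularBasis S) {δ : ℝ} {φ : ℝ → ℝ} {σ : ℤ → ℝ}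

lemma measurable_joint (n : ℕ) :
    Measurable fun q : (B.Idx → ℝ) × (B.Idx → ℝ) =>
      (B.ofCoeff δ (q.1 + (√(n : ℝ))⁻¹ • q.2), B.series q.1) :=
  ((B.measurable_ofCoeff δ).comp (by fun_prop)).prodMk (B.measurable_series.comp measurable_fst)

/-- The disintegration property defining the posterior, pulled back to the independent coefficient
and noise arrays so that product structure can be used. -/
lemma comp_compProd_post (hδ : 1 / 2 < δ) (hφ : Measurable φ)
    (hmass : ∫⁻ x, ENNReal.ofReal (φ x) = 1) (hsq : Integrable fun x => x ^ 2 * φ x)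
    (hσ : ∀ l ∈ B.L, 0 < σ l) (hσs : Summable fun i : B.Idx => σ i.1.1 ^ 2) {n : ℕ}
    {post : Kernel (B.H δ) L2} [IsMarkovKernel post]
    (hpost : B.IsPosterior δ n (B.productPrior φ σ) post) :
    (B.experiment δ n ∘ₘ B.productPrior φ σ) ⊗ₘ post =
      ((Measure.infinitePi (B.coordLaw φ σ)).prod B.gaussianArray).map
        fun q => (B.ofCoeff δ (q.1 + (√(n : ℝ))⁻¹ • q.2), B.series q.1) := by
  have hm : Measurable fun q : (B.Idx → ℝ) × (B.Idx → ℝ) =>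
      (B.series q.1, B.ofCoeff δ (q.1 + (√(n : ℝ))⁻¹ • q.2)) :=
    measurable_swap.comp (B.measurable_joint n)
  rw [Measure.compProd_congr hpost, compProd_posterior_eq_map_swap,
    B.compProd_experiment hδ hφ hmass hsq hσ hσs, Measure.map_map measurable_swap hm]
  rfl

lemma integrable_snd_compProd_post (hδ : 1 / 2 < δ) (hφ : Measurable φ)
    (hmass : ∫⁻ x, ENNReal.ofReal (φ x) = 1) (hsq : Integrable fun x => x ^ 2 * φ x)
    (hσ : ∀ l ∈ B.L, 0 < σ l) (hσs : Summable fun i : B.Idx => σ i.1.1 ^ 2) {n : ℕ}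
    {post : Kernel (B.H δ) L2} [IsMarkovKernel post]
    (hpost : B.IsPosterior δ n (B.productPrior φ σ) post) :
    Integrable (fun z : B.H δ × L2 => z.2)
      ((B.experiment δ n ∘ₘ B.productPrior φ σ) ⊗ₘ post) := by
  have := B.isProbabilityMeasure_coordLaw hφ hmass hσ
  rw [B.comp_compProd_post hδ hφ hmass hsq hσ hσs hpost]
  refine (integrable_map_measure measurable_snd.aestronglyMeasurable
    (B.measurable_joint n).aemeasurable).2 ?_
  exact (B.integrable_series hφ hmass hsq hσ hσs).comp_fst B.gaussianArray

lemma ae_coord_ofCoeff (hδ : 1 / 2 < δ) (hφ : Measurable φ)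
    (hmass : ∫⁻ x, ENNReal.ofReal (φ x) = 1) (hsq : Integrable fun x => x ^ 2 * φ x)
    (hσ : ∀ l ∈ B.L, 0 < σ l) (hσs : Summable fun i : B.Idx => σ i.1.1 ^ 2) (r : ℝ) :
    ∀ᵐ q ∂(Measure.infinitePi (B.coordLaw φ σ)).prod B.gaussianArray,
      ∀ i, B.ofCoeff δ (q.1 + r • q.2) i = q.1 i + r * q.2 i ∧ B.coeff (B.series q.1) i = q.1 i := by
  have := B.isProbabilityMeasure_coordLaw hφ hmass hσ
  filter_upwards [Measure.quasiMeasurePreserving_fst.ae (B.ae_summable_sq hφ hmass hsq hσ hσs),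
    Measure.quasiMeasurePreserving_snd.ae (B.ae_memLp_gaussianArray hδ)] with q h1 h2 i
  refine ⟨?_, B.coeff_series h1 i⟩
  rw [B.ofCoeff_apply ((B.memLp_of_summable_sq hδ h1).add (h2.const_smul r))]
  rfl

/-- The coefficients of the posterior mean are the posterior means of the scalar models. -/
lemma ae_integral_coeff_post (hδ : 1 / 2 < δ) (hφ : Measurable φ) (h0 : ∀ x, 0 ≤ φ x)
    (hmass : ∫⁻ x, ENNReal.ofReal (φ x) = 1) {C : ℝ} (hC : ∀ x, φ x ≤ C)
    (hsq : Integrable fun x => x ^ 2 * φ x)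
    (hσ : ∀ l ∈ B.L, 0 < σ l) (hσs : Summable fun i : B.Idx => σ i.1.1 ^ 2) {n : ℕ}
    {post : Kernel (B.H δ) L2} [IsMarkovKernel post]
    (hpost : B.IsPosterior δ n (B.productPrior φ σ) post) (i : B.Idx) :
    (fun x => ∫ f, B.coeff f i ∂post x) =ᵐ[B.experiment δ n ∘ₘ B.productPrior φ σ]
      fun x => condMean (B.coordDensity φ σ i) (√(n : ℝ))⁻¹ (x i) := by
  have hπ := B.isProbabilityMeasure_coordLaw hφ hmass hσ
  have := B.isProbabilityMeasure_productPrior hφ hmass hσ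
  set r := (√(n : ℝ))⁻¹
  have hJ := B.comp_compProd_post hδ hφ hmass hsq hσ hσs hpost
  have hcoord := B.ae_coord_ofCoeff hδ hφ hmass hsq hσ hσs r
  have hid := B.integrable_id_coordLaw hφ hmass hsq hσ i
  have hpm := B.measurable_coordDensity (σ := σ) hφ i
  have hp0 := B.coordDensity_nonneg h0 hσ i
  have hpC := B.coordDensity_le hC hσ i
  have hcm := measurable_condMean hpm r
  have hm2 : Measurable fun x : B.H δ => condMean (B.coordDensity φ σ i) r (x i) :=
    hcm.comp (B.measurable_coord i)
  have hX : Measurable fun q : (B.Idx → ℝ) × (B.Idx → ℝ) => B.ofCoeff δ (q.1 + r • q.2) :=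
    (B.measurable_ofCoeff δ).comp (by fun_prop)
  have hmarg : B.experiment δ n ∘ₘ B.productPrior φ σ =
      ((Measure.infinitePi (B.coordLaw φ σ)).prod B.gaussianArray).map
        fun q => B.ofCoeff δ (q.1 + r • q.2) := by
    rw [← Measure.fst_compProd (B.experiment δ n ∘ₘ B.productPrior φ σ) post, hJ, Measure.fst,
      Measure.map_map measurable_fst (B.measurable_joint n)]
    rfl
  have hg1 : Integrable (fun z : B.H δ × L2 => B.coeff z.2 i)
      ((B.experiment δ n ∘ₘ B.productPrior φ σ) ⊗ₘ post) :=
    (B.integrable_snd_compProd_post hδ hφ hmass hsq hσ hσs hpost).const_inner _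
  have hg2 : Integrable (fun x : B.H δ => condMean (B.coordDensity φ σ i) r (x i))
      (B.experiment δ n ∘ₘ B.productPrior φ σ) := by
    rw [hmarg]
    refine (integrable_map_measure hm2.aestronglyMeasurable
      hX.aemeasurable).2 ?_
    have hev := measurePreserving_eval_pair (B.coordLaw φ σ) (fun _ => gaussianReal 0 1) i
    have h := hev.integrable_comp_of_integrable (integrable_condMean hpm hp0 hpC hid r)
    refine h.congr ?_
    filter_upwards [hcoord] with q hq
    simp only [Function.comp_apply, (hq i).1]
  have hm1 : StronglyMeasurable fun x => ∫ f, B.coeff f i ∂post x :=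
    StronglyMeasurable.integral_kernel
      (continuous_const.inner continuous_id).stronglyMeasurable
  -- Both sides are integrable functions of the observation, so comparing integrals over measurable
  -- sets of observations suffices.
  refine ae_eq_of_forall_setIntegral_eq_of_sigmaFinite
    (fun s _ _ => (((Measure.integrable_compProd_iff hg1.aestronglyMeasurable).1 hg1).2.mono'
      hm1.aestronglyMeasurable
      (Eventually.of_forall fun x => norm_integral_le_integral_norm _)).integrableOn)
    (fun s _ _ => hg2.integrableOn) fun s hs _ => ?_
  have e1 : ∫ x in s, ∫ f, B.coeff f i ∂post x ∂(B.experiment δ n ∘ₘ B.productPrior φ σ) =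
      ∫ q, (B.ofCoeff δ ⁻¹' s).indicator (fun _ => q.1 i) (q.1 + r • q.2)
        ∂(Measure.infinitePi (B.coordLaw φ σ)).prod B.gaussianArray := by
    have h := Measure.setIntegral_compProd hs MeasurableSet.univ hg1.integrableOn
    simp only [Measure.restrict_univ] at h
    rw [← h, hJ, setIntegral_map (hs.prod MeasurableSet.univ)
      (hJ ▸ hg1.aestronglyMeasurable) (B.measurable_joint n).aemeasurable,
      ← integral_indicator (B.measurable_joint n (hs.prod MeasurableSet.univ))]
    refine integral_congr_ae ?_
    filter_upwards [hcoord] with q hq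
    have hmem : q ∈ (fun q : (B.Idx → ℝ) × (B.Idx → ℝ) =>
        (B.ofCoeff δ (q.1 + r • q.2), B.series q.1)) ⁻¹' (s ×ˢ Set.univ) ↔
        q.1 + r • q.2 ∈ B.ofCoeff δ ⁻¹' s := by simp
    by_cases hqs : q.1 + r • q.2 ∈ B.ofCoeff δ ⁻¹' s
    · rw [Set.indicator_of_mem hqs]
      exact (Set.indicator_of_mem (hmem.2 hqs) _).trans (hq i).2
    · rw [Set.indicator_of_notMem hqs]
      exact Set.indicator_of_notMem (fun h => hqs (hmem.1 h)) _
  have e2 : ∫ x in s, condMean (B.coordDensity φ σ i) r (x i)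
        ∂(B.experiment δ n ∘ₘ B.productPrior φ σ) =
      ∫ q, (B.ofCoeff δ ⁻¹' s).indicator
        (fun x => condMean (B.coordDensity φ σ i) r (x i)) (q.1 + r • q.2)
        ∂(Measure.infinitePi (B.coordLaw φ σ)).prod B.gaussianArray := by
    rw [hmarg, setIntegral_map hs hm2.aestronglyMeasurable
      hX.aemeasurable, ← integral_indicator (hX hs)]
    refine integral_congr_ae ?_
    filter_upwards [hcoord] with q hq
    by_cases hqs : q.1 + r • q.2 ∈ B.ofCoeff δ ⁻¹' s
    · rw [Set.indicator_of_mem hqs]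
      refine (Set.indicator_of_mem (a := q) hqs _).trans ?_
      rw [(hq i).1]
      rfl
    · rw [Set.indicator_of_notMem hqs]
      exact Set.indicator_of_notMem (a := q) hqs _
  rw [e1, e2]
  exact setIntegral_coord_eq_condMean (B.coordDensity φ σ) hπ i hpm hp0 hpC hid r
    (B.measurable_ofCoeff δ hs)

end RegularBasis

lemma measurable_postMean {X : Type*} [MeasurableSpace X] (post : Kernel X L2)
    [IsMarkovKernel post] : Measurable (postMean post) :=
  (StronglyMeasurable.integral_kernel (κ := post) (f := fun f : L2 => f)
    measurable_id.stronglyMeasurable).measurable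

/-! ### Asymptotics of the rescaled deviation of the posterior mean. -/

namespace RegularBasis

variable {S : ℕ} (B : RegularBasis S) {δ : ℝ} {φ : ℝ → ℝ} {σ : ℤ → ℝ}

/-- The rescaled difference `√n (f̄_n - 𝕏⁽ⁿ⁾)`. -/
def postDev (post : Kernel (B.H δ) L2) (n : ℕ) (x : B.H δ) : B.H δ :=
  √(n : ℝ) • (B.embed δ (postMean post x) - x)

lemma measurable_postDev (post : Kernel (B.H δ) L2) [IsMarkovKernel post] (n : ℕ) :
    Measurable (B.postDev post n) := by
  have h : Measurable fun x => B.embed δ (postMean post x) :=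
    (B.measurable_embed δ).comp (measurable_postMean post)
  unfold postDev
  fun_prop

/-- The injection into H(δ) is continuous and linear, so it commutes with the Bochner integral. -/
lemma integral_map_embed_sub (hδ : 1 / 2 < δ) {ν : Measure L2} [IsProbabilityMeasure ν]
    (h : Integrable (fun f : L2 => f) ν) (c : ℝ) (x : B.H δ) :
    Integrable (fun y : B.H δ => y) (ν.map fun f => c • (B.embed δ f - x)) ∧
      ∫ y, y ∂(ν.map fun f => c • (B.embed δ f - x)) = c • (B.embed δ (∫ f, f ∂ν) - x) := by
  have hm : Measurable fun f => c • (B.embed δ f - x) :=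
    ((B.measurable_embed δ).sub_const x).const_smul c
  have hi : Integrable (B.embed δ) ν := (B.embedL hδ).integrable_comp h
  constructor
  · refine (integrable_map_measure measurable_id.aestronglyMeasurable hm.aemeasurable).2 ?_
    exact (hi.sub (integrable_const x)).smul c
  · rw [integral_map (f := fun y : B.H δ => y) hm.aemeasurable
      measurable_id.aestronglyMeasurable, integral_smul,
      integral_sub hi (integrable_const x), integral_const, probReal_univ, one_smul]
    congr 2
    exact (B.embedL hδ).integral_comp_comm h

lemma ae_integrable_post (hδ : 1 / 2 < δ) (hφ : Measurable φ)
    (hmass : ∫⁻ x, ENNReal.ofReal (φ x) = 1) (hsq : Integrable fun x => x ^ 2 * φ x)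
    (hσ : ∀ l ∈ B.L, 0 < σ l) (hσs : Summable fun i : B.Idx => σ i.1.1 ^ 2) {n : ℕ} (hn : 1 ≤ n)
    {post : Kernel (B.H δ) L2} [IsMarkovKernel post]
    (hpost : B.IsPosterior δ n (B.productPrior φ σ) post) (f₀ : L2) :
    ∀ᵐ x ∂B.obsLaw δ n f₀, Integrable (fun f : L2 => f) (post x) := by
  have := B.isProbabilityMeasure_productPrior hφ hmass hσ
  have h := B.integrable_snd_compProd_post hδ hφ hmass hsq hσ hσs hpost
  exact (B.obsLaw_absolutelyContinuous_comp hδ hn _ f₀).ae_le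
    ((Measure.integrable_compProd_iff h.aestronglyMeasurable).1 h).1

/-- In `condMean` the observation cancels and √n cancels the noise level; the factor σ⁻¹ of the
prior density drops out by normalization. -/
lemma ae_postDev_coord (hδ : 1 / 2 < δ) (hφ : Measurable φ) (h0 : ∀ x, 0 ≤ φ x)
    (hmass : ∫⁻ x, ENNReal.ofReal (φ x) = 1) {C : ℝ} (hC : ∀ x, φ x ≤ C)
    (hsq : Integrable fun x => x ^ 2 * φ x)
    (hσ : ∀ l ∈ B.L, 0 < σ l) (hσs : Summable fun i : B.Idx => σ i.1.1 ^ 2) {n : ℕ} (hn : 1 ≤ n)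
    {post : Kernel (B.H δ) L2} [IsMarkovKernel post]
    (hpost : B.IsPosterior δ n (B.productPrior φ σ) post) (f₀ : L2) :
    ∀ᵐ x ∂B.obsLaw δ n f₀, ∀ i, B.postDev post n x i =
      tiltedMean fun z => φ ((x i + (√(n : ℝ))⁻¹ * z) / σ i.1.1) := by
  have := B.isProbabilityMeasure_productPrior hφ hmass hσ
  have hn0 : (0 : ℝ) < √(n : ℝ) := Real.sqrt_pos.2 (by exact_mod_cast hn)
  have hall := (B.obsLaw_absolutelyContinuous_comp hδ hn (B.productPrior φ σ) f₀).ae_le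
    (ae_all_iff.2 (B.ae_integral_coeff_post hδ hφ h0 hmass hC hsq hσ hσs hpost))
  filter_upwards [hall, B.ae_integrable_post hδ hφ hmass hsq hσ hσs hn hpost f₀] with x hx hi i
  have h1 : B.coeff (postMean post x) i = ∫ f, B.coeff f i ∂post x :=
    (integral_inner hi (B.basis i)).symm
  rw [postDev, smul_coord, sub_coord, B.embed_apply hδ, h1, hx i, condMean, add_sub_cancel_left,
    mul_inv_cancel_left₀ hn0.ne']
  exact tiltedMean_const_mul (inv_ne_zero (hσ _ i.2.1).ne') _

/-- Tonelli's theorem, with each coefficient written as θ₀ + ε/√n. The result is an integral over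
indices against the finite weight measure, ready for dominated convergence. -/
lemma lintegral_postDev_sq (hδ : 1 / 2 < δ) (hφ : Measurable φ) (h0 : ∀ x, 0 ≤ φ x)
    (hmass : ∫⁻ x, ENNReal.ofReal (φ x) = 1) {C : ℝ} (hC : ∀ x, φ x ≤ C)
    (hsq : Integrable fun x => x ^ 2 * φ x)
    (hσ : ∀ l ∈ B.L, 0 < σ l) (hσs : Summable fun i : B.Idx => σ i.1.1 ^ 2) {n : ℕ} (hn : 1 ≤ n)
    {post : Kernel (B.H δ) L2} [IsMarkovKernel post]
    (hpost : B.IsPosterior δ n (B.productPrior φ σ) post) (f₀ : L2) :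
    ∫⁻ x, ‖B.postDev post n x‖ₑ ^ 2 ∂B.obsLaw δ n f₀ =
      ∫⁻ i, (∫⁻ ε, ENNReal.ofReal (tiltedMean (fun z =>
        φ (B.coeff f₀ i / σ i.1.1 + (ε + z) / (σ i.1.1 * √(n : ℝ)))) ^ 2) ∂gaussianReal 0 1)
        ∂B.weightMeasure (-1 / 2) δ := by
  have hn0 : (0 : ℝ) < √(n : ℝ) := Real.sqrt_pos.2 (by exact_mod_cast hn)
  have hm : ∀ i : B.Idx, Measurable fun ε => tiltedMean (fun z =>
      φ (B.coeff f₀ i / σ i.1.1 + (ε + z) / (σ i.1.1 * √(n : ℝ)))) := fun i =>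
    measurable_tiltedMean (f := fun ε z : ℝ =>
      φ (B.coeff f₀ i / σ i.1.1 + (ε + z) / (σ i.1.1 * √(n : ℝ)))) (hφ.comp (by fun_prop))
  have hae := B.ae_postDev_coord hδ hφ h0 hmass hC hsq hσ hσs hn hpost f₀
  rw [obsLaw_eq_map] at hae ⊢
  rw [lintegral_map ((B.measurable_postDev post n).enorm.pow_const 2) (B.measurable_obs n f₀)]
  have hae' := ae_of_ae_map (B.measurable_obs n f₀).aemeasurable hae
  have hstep : ∀ᵐ ε ∂B.gaussianArray,
      ‖B.postDev post n (B.embed δ f₀ + (√(n : ℝ))⁻¹ • B.ofCoeff δ ε)‖ₑ ^ 2 =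
        ∑' i, ENNReal.ofReal (B.weight (-1 / 2) δ i) * ENNReal.ofReal (tiltedMean (fun z =>
          φ (B.coeff f₀ i / σ i.1.1 + (ε i + z) / (σ i.1.1 * √(n : ℝ)))) ^ 2) := by
    filter_upwards [hae', B.ae_memLp_gaussianArray hδ] with ε hε hmem
    rw [enorm_sq]
    refine tsum_congr fun i => ?_
    have hσi := (hσ _ i.2.1).ne'
    rw [hε i, add_coord, smul_coord, B.embed_apply hδ, B.ofCoeff_apply hmem]
    congr 5
    ext z
    congr 1
    field_simp
    ring
  have hm' : ∀ i : B.Idx, Measurable fun ε : B.Idx → ℝ => tiltedMean (fun z =>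
      φ (B.coeff f₀ i / σ i.1.1 + (ε i + z) / (σ i.1.1 * √(n : ℝ)))) := fun i =>
    (hm i).comp (measurable_pi_apply i)
  rw [lintegral_congr_ae hstep, lintegral_tsum fun i =>
    (((hm' i).pow_const 2).ennreal_ofReal.const_mul _).aemeasurable, lintegral_weightMeasure]
  refine tsum_congr fun i => ?_
  rw [lintegral_const_mul' _ _ ENNReal.ofReal_ne_top, gaussianArray,
    ← (measurePreserving_eval_infinitePi (fun _ : B.Idx => gaussianReal 0 1) i).lintegral_comp
      ((hm i).pow_const 2).ennreal_ofReal]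

/-- The posterior mean is asymptotically linear in mean square. -/
lemma tendsto_lintegral_postDev_sq (hδ : 1 / 2 < δ) (hφ : Measurable φ) (h0 : ∀ x, 0 ≤ φ x)
    (hmass : ∫⁻ x, ENNReal.ofReal (φ x) = 1) {M τ c C : ℝ} (hC : ∀ x, φ x ≤ C)
    (hsq : Integrable fun x => x ^ 2 * φ x)
    (hσ : ∀ l ∈ B.L, 0 < σ l) (hσs : Summable fun i : B.Idx => σ i.1.1 ^ 2)
    {post : ℕ → Kernel (B.H δ) L2} [∀ n, IsMarkovKernel (post n)]
    (hpost : ∀ n, 1 ≤ n → B.IsPosterior δ n (B.productPrior φ σ) (post n)) (f₀ : L2)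
    (hf₀ : ∀ i : B.Idx, |B.coeff f₀ i| / σ i.1.1 ≤ M) (hc : 0 < c) (hM : M < τ)
    (hge : ∀ x ∈ Set.Ioo (-τ) τ, c ≤ φ x)
    (hcont : ∀ i : B.Idx, ContinuousAt φ (B.coeff f₀ i / σ i.1.1)) :
    Tendsto (fun n => ∫⁻ x, ‖B.postDev (post n) n x‖ₑ ^ 2 ∂B.obsLaw δ n f₀) atTop (𝓝 0) := by
  have ht₀ : ∀ i : B.Idx, |B.coeff f₀ i / σ i.1.1| ≤ M := fun i => by
    rw [abs_div, abs_of_pos (hσ _ i.2.1)]; exact hf₀ i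
  obtain ⟨K, hK0, hK⟩ := exists_lintegral_tiltedMean_sq_le hφ h0 hmass hC hc hge hM
  have h := tendsto_lintegral_filter_of_dominated_convergence
    (μ := B.weightMeasure (-1 / 2) δ) (l := atTop)
    (F := fun (n : ℕ) i => ∫⁻ ε, ENNReal.ofReal (tiltedMean (fun z =>
        φ (B.coeff f₀ i / σ i.1.1 + (ε + z) / (σ i.1.1 * √(n : ℝ)))) ^ 2) ∂gaussianReal 0 1)
    (f := fun _ => 0) (fun _ => ENNReal.ofReal K)
    (Eventually.of_forall fun n => measurable_of_countable _) ?_ ?_ ?_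
  · rw [lintegral_zero] at h
    refine h.congr' ?_
    filter_upwards [eventually_ge_atTop 1] with n hn
    exact (B.lintegral_postDev_sq hδ hφ h0 hmass hC hsq hσ hσs hn (hpost n hn) f₀).symm
  · filter_upwards [eventually_ge_atTop 1] with n hn
    have hn0 : (0 : ℝ) < √(n : ℝ) := Real.sqrt_pos.2 (by exact_mod_cast hn)
    exact Eventually.of_forall fun i => hK _ _ (ht₀ i) (mul_pos (hσ _ i.2.1) hn0)
  · rw [lintegral_weightMeasure, ENNReal.tsum_mul_right]
    exact ENNReal.mul_ne_top (B.summable_weight hδ).tsum_ofReal_ne_top ENNReal.ofReal_ne_top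
  · refine Eventually.of_forall fun i => ?_
    refine tendsto_lintegral_tiltedMean_sq hφ h0 hC hc hge (ht₀ i) hM (hcont i) ?_
    exact (Real.tendsto_sqrt_atTop.comp tendsto_natCast_atTop_atTop).const_mul_atTop (hσ _ i.2.1)

lemma tendsto_measure_postDev {post : ℕ → Kernel (B.H δ) L2}
    [∀ n, IsMarkovKernel (post n)] {f₀ : L2}
    (h : Tendsto (fun n => ∫⁻ x, ‖B.postDev (post n) n x‖ₑ ^ 2 ∂B.obsLaw δ n f₀) atTop (𝓝 0))
    {ε : ℝ} (hε : 0 < ε) :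
    Tendsto (fun n => B.obsLaw δ n f₀ {x | ε ≤ ‖B.postDev (post n) n x‖}) atTop (𝓝 0) := by
  have hε' : ENNReal.ofReal ε ^ 2 ≠ 0 := by simp [hε]
  have h1 := ENNReal.Tendsto.div_const h (b := ENNReal.ofReal ε ^ 2) (Or.inr hε')
  rw [ENNReal.zero_div] at h1
  refine tendsto_of_tendsto_of_tendsto_of_le_of_le tendsto_const_nhds h1 (fun n => zero_le)
    fun n => ?_
  refine le_trans (measure_mono fun x hx => ?_) (meas_ge_le_lintegral_div
    ((B.measurable_postDev (post n) n).enorm.pow_const 2).aemeasurable hε'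
    (ENNReal.pow_ne_top ENNReal.ofReal_ne_top))
  change ENNReal.ofReal ε ^ 2 ≤ ‖B.postDev (post n) n x‖ₑ ^ 2
  rw [← ofReal_norm]
  exact pow_le_pow_left' (ENNReal.ofReal_le_ofReal hx) 2

/-- Convergence to zero in probability persists under local perturbations. -/
lemma tendsto_measure_local (hδ : 1 / 2 < δ) {f₀ : L2} (h : L2) {A : ℕ → Set (B.H δ)}
    (hA : ∀ n, MeasurableSet (A n))
    (hlim : Tendsto (fun n => B.obsLaw δ n f₀ (A n)) atTop (𝓝 0)) :
    Tendsto (fun n : ℕ => B.obsLaw δ n (f₀ + (√(n : ℝ))⁻¹ • h) (A n)) atTop (𝓝 0) := by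
  set K := ENNReal.ofReal (Real.exp (‖h‖ ^ 2))
  have h1 := ENNReal.Tendsto.const_mul (a := K) hlim (Or.inr ENNReal.ofReal_ne_top)
  have h2 := h1.ennrpow_const (1 / 2 : ℝ)
  rw [mul_zero, ENNReal.zero_rpow_of_pos (by norm_num)] at h2
  refine tendsto_of_tendsto_of_tendsto_of_le_of_le' tendsto_const_nhds h2
    (Eventually.of_forall fun n => zero_le) ?_
  filter_upwards [eventually_ge_atTop 1] with n hn
  have hn0 : (0 : ℝ) < n := by exact_mod_cast hn
  have hle := B.obsLaw_add_sq_le hδ hn f₀ ((√(n : ℝ))⁻¹ • h) (hA n)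
  -- At the scale 1/√n the Cameron-Martin constant does not depend on `n`.
  have hnorm : (n : ℝ) * ‖(√(n : ℝ))⁻¹ • h‖ ^ 2 = ‖h‖ ^ 2 := by
    rw [norm_smul, mul_pow, norm_inv, inv_pow, Real.norm_eq_abs, sq_abs, Real.sq_sqrt hn0.le,
      mul_inv_cancel_left₀ hn0.ne']
  rw [hnorm] at hle
  rwa [one_div, ENNReal.le_rpow_inv_iff (by norm_num), ENNReal.rpow_two]

/-- All observations are realized on the one space of noise arrays. There, for n ≥ 1, the rescaled
error minus the white noise is exactly `postDev`, which is negligible under the local alternatives,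
so Slutsky's lemma applies. -/
lemma tendstoInDistribution_postMean (hδ : 1 / 2 < δ) {post : ℕ → Kernel (B.H δ) L2}
    [∀ n, IsMarkovKernel (post n)] {f₀ : L2}
    (hlim : ∀ ε : ℝ, 0 < ε →
      Tendsto (fun n => B.obsLaw δ n f₀ {x | ε ≤ ‖B.postDev (post n) n x‖}) atTop (𝓝 0))
    (h : L2) :
    TendstoInDistribution
      (fun (n : ℕ) (x : B.H δ) => √(n : ℝ) •
        (B.embed δ (postMean (post n) x) - B.embed δ (f₀ + (√(n : ℝ))⁻¹ • h)))
      atTop (fun w : B.H δ => w)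
      (fun n : ℕ => B.obsLaw δ n (f₀ + (√(n : ℝ))⁻¹ • h)) (B.stdGaussian δ) := by
  set X : ℕ → (B.Idx → ℝ) → B.H δ := fun n ε =>
    B.embed δ (f₀ + (√(n : ℝ))⁻¹ • h) + (√(n : ℝ))⁻¹ • B.ofCoeff δ ε with hXdef
  have hX : ∀ n, Measurable (X n) := fun n => B.measurable_obs n _
  set Y : ℕ → B.H δ → B.H δ := fun n x => √(n : ℝ) •
    (B.embed δ (postMean (post n) x) - B.embed δ (f₀ + (√(n : ℝ))⁻¹ • h)) with hYdef
  have hY : ∀ n, Measurable (Y n) := fun n => by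
    have h : Measurable fun x => B.embed δ (postMean (post n) x) :=
      (B.measurable_embed δ).comp (measurable_postMean (post n))
    fun_prop
  have hconst : TendstoInDistribution (fun _ : ℕ => B.ofCoeff δ) atTop (fun w : B.H δ => w)
      (fun _ => B.gaussianArray) (B.stdGaussian δ) := by
    refine ⟨fun _ => (B.measurable_ofCoeff δ).aemeasurable, by fun_prop, ?_⟩
    refine tendsto_const_nhds.congr fun _ => ?_
    refine Subtype.ext ?_
    simp [stdGaussian]
  have hmeas : TendstoInMeasure B.gaussianArray ((fun n => Y n ∘ X n) - fun _ => B.ofCoeff δ)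
      atTop 0 := by
    rw [tendstoInMeasure_iff_norm]
    intro ε hε
    have hA : ∀ n, MeasurableSet {x | ε ≤ ‖B.postDev (post n) n x‖} := fun n =>
      measurableSet_le measurable_const (B.measurable_postDev (post n) n).norm
    refine (B.tendsto_measure_local hδ h hA (hlim ε hε)).congr' ?_
    filter_upwards [eventually_ge_atTop 1] with n hn
    have hn0 : (0 : ℝ) < √(n : ℝ) := Real.sqrt_pos.2 (by exact_mod_cast hn)
    rw [obsLaw_eq_map, Measure.map_apply (hX n) (hA n)]
    congr 1
    ext ε'
    change ε ≤ ‖B.postDev (post n) n (X n ε')‖ ↔ ε ≤ ‖Y n (X n ε') - B.ofCoeff δ ε' - 0‖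
    have : B.postDev (post n) n (X n ε') = Y n (X n ε') - B.ofCoeff δ ε' - 0 := by
      rw [sub_zero, postDev, hYdef]
      simp only [smul_sub]
      rw [sub_sub]
      congr 1
      rw [hXdef]
      simp only [smul_add, smul_inv_smul₀ hn0.ne']
    rw [this]
  have hmain := tendstoInDistribution_of_tendstoInMeasure_sub _ _ hconst hmeas
    fun n => ((hY n).comp (hX n)).aemeasurable
  -- Convergence in distribution depends only on the image laws, so the coupling can be undone.
  refine ⟨fun n => (hY n).aemeasurable, by fun_prop, hmain.tendsto.congr fun n => ?_⟩
  refine Subtype.ext ?_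
  change B.gaussianArray.map (Y n ∘ X n) = (B.obsLaw δ n _).map (Y n)
  rw [obsLaw_eq_map, Measure.map_map (hY n) (hX n)]

end RegularBasis

end WhiteNoise

end

theorem theorem4p6 {S : ℕ} (B : WhiteNoise.RegularBasis S)
    -- the base density and the scales
    (φ : ℝ → ℝ) (hφ_meas : Measurable φ) (hφ_nonneg : ∀ x, 0 ≤ φ x)
    (hφ_int : ∫⁻ x, ENNReal.ofReal (φ x) = 1)
    (σ : ℤ → ℝ) (hσ_pos : ∀ l ∈ B.L, 0 < σ l)
    (hσ_sum : Summable fun i : B.Idx => σ i.1.1 ^ 2)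
    -- the true function, with coefficients bounded by `M σ_l`
    (f₀ : WhiteNoise.L2) (M : ℝ) (hM : 0 < M) (hP1 : ∀ i : B.Idx, |B.coeff f₀ i| / σ i.1.1 ≤ M)
    -- the base density is bounded, bounded below on `(-τ, τ)`, with finite second moment
    (τ c C : ℝ) (hτ : M < τ) (hc : 0 < c) (hcC : c ≤ C)
    (hφ_le : ∀ x, φ x ≤ C) (hφ_ge : ∀ x ∈ Set.Ioo (-τ) τ, c ≤ φ x)
    (hφ_sq : Integrable fun x => x ^ 2 * φ x)
    -- `φ_{lk}` is continuous near `θ_{0,lk}`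
    (hφ_cont : ∀ i : B.Idx, ∀ᶠ x in 𝓝 (B.coeff f₀ i / σ i.1.1), ContinuousAt φ x)
    (δ : ℝ) (hδ : 1 / 2 < δ)
    -- the posterior distributions
    (post : ℕ → Kernel (B.H δ) WhiteNoise.L2) [∀ n, IsMarkovKernel (post n)]
    (hpost : ∀ n, 1 ≤ n → B.IsPosterior δ n (B.productPrior φ σ) (post n)) :
    -- the posterior mean exists and `E[Y_n | 𝕏⁽ⁿ⁾] = √n (f̄_n - 𝕏⁽ⁿ⁾)`
    (∀ n : ℕ, 1 ≤ n → ∀ᵐ x ∂(B.obsLaw δ n f₀),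
      Integrable (fun f : WhiteNoise.L2 => f) (post n x) ∧
      Integrable (fun y : B.H δ => y)
        ((post n x).map fun f => √(n : ℝ) • (B.embed δ f - x)) ∧
      ∫ y, y ∂((post n x).map fun f => √(n : ℝ) • (B.embed δ f - x)) =
        √(n : ℝ) • (B.embed δ (WhiteNoise.postMean (post n) x) - x)) ∧
    -- `√n (f̄_n - 𝕏⁽ⁿ⁾) → 0` in `H(δ)` in `P_{f₀}^n`-probability
    (∀ ε : ℝ, 0 < ε → Tendsto
      (fun n : ℕ => B.obsLaw δ n f₀
        {x | ε ≤ ‖√(n : ℝ) • (B.embed δ (WhiteNoise.postMean (post n) x) - x)‖})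
      atTop (𝓝 0)) ∧
    -- efficiency: `√n (f̄_n - f) → 𝒩` in law under `P_f^n`, for all local sequences
    -- `f = f₀ + h / √n`
    (∀ h : WhiteNoise.L2, TendstoInDistribution
      (fun (n : ℕ) (x : B.H δ) => √(n : ℝ) •
        (B.embed δ (WhiteNoise.postMean (post n) x) - B.embed δ (f₀ + (√(n : ℝ))⁻¹ • h)))
      atTop (fun w : B.H δ => w)
      (fun n : ℕ => B.obsLaw δ n (f₀ + (√(n : ℝ))⁻¹ • h)) (B.stdGaussian δ)) := by
  have hlim : ∀ ε : ℝ, 0 < ε → Tendsto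
      (fun n : ℕ => B.obsLaw δ n f₀ {x | ε ≤ ‖B.postDev (post n) n x‖}) atTop (𝓝 0) :=
    fun ε hε => B.tendsto_measure_postDev
      (B.tendsto_lintegral_postDev_sq hδ hφ_meas hφ_nonneg hφ_int hφ_le hφ_sq hσ_pos hσ_sum hpost
        f₀ hP1 hc hτ hφ_ge fun i => (hφ_cont i).self_of_nhds) hε
  refine ⟨fun n hn => ?_, hlim, B.tendstoInDistribution_postMean hδ hlim⟩
  filter_upwards [B.ae_integrable_post hδ hφ_meas hφ_int hφ_sq hσ_pos hσ_sum hn (hpost n hn) f₀]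
    with x hx
  exact ⟨hx, B.integral_map_embed_sub hδ hx _ x⟩
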